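/- Let $\lambda$ denote Lebesgue measure on $[0,1]$. A graphon is a symmetric Lebesgue measurable function $U:[0,1]^2\to[0,1]$; let $\mathcal W$ be the set of all graphons. For $U,V\in\mathcal W$ put $$d_\Box(U,V):=\sup_{A,B}\Big|\int_{A\times B}(U-V)\,\mathrm d\lambda^{\oplus 2}\Big|,\qquad \delta_\Box(U,V):=\inf_{\phi,\psi}d_\Box(U^\phi,V^\psi),$$ where $A,B$ range over all measurable subsets of $[0,1]$, $\phi,\psi$ range over all measure-preserving maps $[0,1]\to[0,1]$, and $U^\phi(x,y):=U(\phi(x),\phi(y))$. Then $\delta_\Box$ is a pseudo-metric on $\mathcal W$. For $U\in\mathcal W$ let $\widetilde U:=\{V\in\mathcal W:\delta_\Box(U,V)=0\}$, and let $\widetilde{\mathcal W}:=\{\widetilde U:U\in\mathcal W\}$ be the quotient space with the metric induced by $\delta_\Box$. For $p,\rho\in[0,1]$ let $$h_p(\rho):=\rho\log\frac{\rho}{p}+(1-\rho)\log\frac{1-\rho}{1-p}\in[0,\infty],$$ with the conventions $0\log 0=0\log\frac00=0$, $h_0(\rho)=+\infty$ for $\rho\ne0$, and $h_1(\rho)=+\infty$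 for $\rho\neq1$. Let $k\ge1$ be an integer. For a non-zero vector $\alpha=(\alpha_1,\dots,\alpha_k)\in[0,\infty)^k$ let $(I^\alpha_1,\dots,I^\alpha_k)$ be the partition of $[0,1]$ into consecutive intervals such that $I^\alpha_i$ has length $\alpha_i/(\alpha_1+\dots+\alpha_k)$. For a symmetric matrix $p=(p_{i,j})\in[0,1]^{k\times k}$ define $J_{\alpha,p}:\widetilde{\mathcal W}\to[0,\infty]$ by $$J_{\alpha,p}(\widetilde U):=\inf_{V\in\widetilde U}\ \frac12\sum_{i,j=1}^k\int_{I^\alpha_i\times I^\alpha_j}h_{p_{i,j}}(V(x,y))\,\mathrm dx\,\mathrm dy .$$ **Theorem.** For every integer $k\ge 1$, every symmetric matrix $p\in[0,1]^{k\times k}$ and every non-zero vector $\alpha\in[0,\infty)^k$, the function $J_{\alpha,p}$ is lower semi-continuous on the metric space $(\widetilde{\mathcal W},\delta_\Box)$; that is, for each $r\in\mathbb R$ the set $\{x\in\widetilde{\mathcal W}:J_{\alpha,p}(x)\le r\}$ is closed. -/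

import Mathlib

open MeasureTheory Set
open scoped ENNReal unitInterval

noncomputable section

namespace BlockLDP

/-- A graphon: a symmetric Lebesgue measurable function `[0,1]² → [0,1]`. Here `I` is `[0,1]` with
Lebesgue measure, and `volume` on `I × I` is the (Borel) product measure; for a real function,
almost-everywhere measurability with respect to it is the same as measurability with respect to
its completion, that is, Lebesgue measurability. -/
structure Graphon where
  toFun : I × I → ℝ
  mem_Icc : ∀ z, toFun z ∈ Icc (0 : ℝ) 1
  symm : ∀ x y, toFun (x, y) = toFun (y, x)
  aemeasurable : AEMeasurable toFun volume

/-- Lebesgue measurable, measure-preserving maps `[0,1] → [0,1]` (not necessarily injective). -/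
structure IsMeasPres (φ : I → I) : Prop where
  aemeasurable : AEMeasurable φ volume
  map_eq : Measure.map φ volume = volume

theorem IsMeasPres.id : IsMeasPres (fun x => x) :=
  ⟨aemeasurable_id', Measure.map_id'⟩

theorem IsMeasPres.prodMap {φ : I → I} (h : IsMeasPres φ) :
    AEMeasurable (Prod.map φ φ) volume ∧
      Measure.map (Prod.map φ φ) (volume : Measure (I × I)) = volume := by
  obtain ⟨ψ, hψ, hφψ⟩ := h.aemeasurable
  have hmap : Measure.map ψ volume = volume := by
    rw [← Measure.map_congr hφψ, h.map_eq]
  have hmp : MeasurePreserving ψ volume volume := ⟨hψ, hmap⟩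
  have h2 := hmp.prod hmp
  have hae : Prod.map φ φ =ᵐ[(volume : Measure (I × I))] Prod.map ψ ψ := by
    have h1 : ∀ᵐ z ∂(volume : Measure (I × I)), φ z.1 = ψ z.1 :=
      Measure.quasiMeasurePreserving_fst.ae hφψ
    have h2 : ∀ᵐ z ∂(volume : Measure (I × I)), φ z.2 = ψ z.2 :=
      Measure.quasiMeasurePreserving_snd.ae hφψ
    filter_upwards [h1, h2] with z hz1 hz2
    simp [Prod.map, hz1, hz2]
  refine ⟨⟨_, h2.measurable, hae⟩, ?_⟩
  rw [Measure.map_congr hae]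
  exact h2.map_eq

/-- The pull-back `U^φ (x, y) = U (φ x, φ y)` along a measure-preserving map. -/
def Graphon.pullback (U : Graphon) (φ : I → I) (h : IsMeasPres φ) : Graphon where
  toFun z := U.toFun (φ z.1, φ z.2)
  mem_Icc _ := U.mem_Icc _
  symm _ _ := U.symm _ _
  aemeasurable := by
    have h2 := h.prodMap
    have hU : AEMeasurable U.toFun (Measure.map (Prod.map φ φ) volume) := by
      rw [h2.2]
      exact U.aemeasurable
    exact hU.comp_aemeasurable h2.1

/-- `d_□(U, V) = sup_{A, B} |∫_{A × B} (U - V)|` over Lebesgue measurable `A, B ⊆ [0,1]`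
(the set of values is non-empty and bounded by `1`). -/
def cutNormDist (U V : Graphon) : ℝ :=
  sSup {r : ℝ | ∃ A B : Set I, NullMeasurableSet A volume ∧ NullMeasurableSet B volume ∧
    r = |∫ z in A ×ˢ B, (U.toFun z - V.toFun z)|}

/-- The cut-distance `δ_□(U, V) = inf_{φ, ψ} d_□(U^φ, V^ψ)` over all pairs of measure-preserving
maps. -/
def cutDist (U V : Graphon) : ℝ :=
  sInf {r : ℝ | ∃ (φ ψ : I → I) (hφ : IsMeasPres φ) (hψ : IsMeasPres ψ),
    r = cutNormDist (U.pullback φ hφ) (V.pullback ψ hψ)}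

/-- The weak isomorphism class of a graphon. -/
def weakIsoClass (U : Graphon) : Set Graphon := {V | cutDist U V = 0}

/-- The space of weak isomorphism classes of graphons. -/
structure GraphonSpace where
  carrier : Set Graphon
  exists_rep : ∃ U, carrier = weakIsoClass U

/-- The cut-distance between weak isomorphism classes. As `cutDist` is a pseudo-metric,
it does not depend on the representatives, so the infimum over them is their common value. -/
def GraphonSpace.cutDist (S T : GraphonSpace) : ℝ :=
  sInf {r : ℝ | ∃ U ∈ S.carrier, ∃ V ∈ T.carrier, r = BlockLDP.cutDist U V}

/-- The topology of the cut-distance: a set is open when it contains, with each of its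
points, a ball of positive radius around this point. -/
instance GraphonSpace.instTopologicalSpace : TopologicalSpace GraphonSpace where
  IsOpen G := ∀ S ∈ G, ∃ ε > 0, ∀ T, GraphonSpace.cutDist S T < ε → T ∈ G
  isOpen_univ _ _ := ⟨1, one_pos, fun _ _ => mem_univ _⟩
  isOpen_inter G H hG hH S hS := by
    obtain ⟨ε, hε, h1⟩ := hG S hS.1
    obtain ⟨η, hη, h2⟩ := hH S hS.2
    exact ⟨min ε η, lt_min hε hη, fun T hT =>
      ⟨h1 T (hT.trans_le (min_le_left _ _)), h2 T (hT.trans_le (min_le_right _ _))⟩⟩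
  isOpen_sUnion C hC S hS := by
    obtain ⟨G, hG, hSG⟩ := hS
    obtain ⟨ε, hε, h⟩ := hC G hG S hSG
    exact ⟨ε, hε, fun T hT => ⟨G, hG, h T hT⟩⟩

/-- The relative entropy `h_p(ρ) = ρ log (ρ/p) + (1-ρ) log ((1-ρ)/(1-p))` for `p, ρ ∈ [0,1]`, with
`0 log 0 = 0 log (0/0) = 0`, `h_0(ρ) = ∞` for `ρ ≠ 0` and `h_1(ρ) = ∞` for `ρ ≠ 1`. The real
expression in the last case is non-negative on `[0,1]`, so that `ENNReal.ofReal` truncates nothing. -/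
def relEntropy (p ρ : ℝ) : ℝ≥0∞ :=
  open Classical in
  if (p = 0 ∧ ρ ≠ 0) ∨ (p = 1 ∧ ρ ≠ 1) then ⊤
  else ENNReal.ofReal
    (ρ * Real.log (ρ / p) + (1 - ρ) * Real.log ((1 - ρ) / (1 - p)))

/-- The `i`-th of the `k` consecutive intervals that partition `[0,1]` and have lengths
`α_i / ‖α‖₁`; a dividing point belongs to the interval on its right, and `1` to the last one. -/
def blockInterval {k : ℕ} (α : Fin k → ℝ) (i : Fin k) : Set I :=
  {x | (∑ j ∈ Finset.Iio i, α j) / ∑ j, α j ≤ (x : ℝ) ∧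
    ((x : ℝ) < (∑ j ∈ Finset.Iic i, α j) / ∑ j, α j ∨ (i : ℕ) + 1 = k)}

/-- `½ ∑_{i,j} ∫_{I_i × I_j} h_{p_{i,j}}(V(x,y)) dx dy` with the blocks `I_i` given by `α`. -/
def blockEntropy {k : ℕ} (α : Fin k → ℝ) (p : Matrix (Fin k) (Fin k) ℝ) (V : Graphon) : ℝ≥0∞ :=
  2⁻¹ * ∑ i, ∑ j, ∫⁻ z in blockInterval α i ×ˢ blockInterval α j, relEntropy (p i j) (V.toFun z)

/-- The rate function `J_{α,p}`: the infimum of the blockwise relative entropy over all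
representatives of the weak isomorphism class. -/
def rateJ {k : ℕ} (α : Fin k → ℝ) (p : Matrix (Fin k) (Fin k) ℝ) (S : GraphonSpace) : ℝ≥0∞ :=
  ⨅ V ∈ S.carrier, blockEntropy α p V

end BlockLDP

end

/-!
Suppose that classes `T n` converge to the class of `U` in the cut-distance, and that each has a
representative `V n` of block entropy at most `C`. The task is to find a representative of the class
of `U` with block entropy at most `C`; it will be a pull-back `U^θ`.

Closeness in cut-distance is recast as the existence of a coupling `π n` of Lebesgue measure with
itself under which `U` and `V n` are close in cut norm (`CouplingClose`). Couplings can be glued, so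
that this relation satisfies the triangle inequality, and it can be followed from `U` through the
chosen representatives to `V n` (`couplingClose_of_mem_of_cutDist_lt`).

Under `π n`, the block of the point of `V n` is a random label of the point of `U`. The measures
`A ↦ π n (A × I_i)` lie below Lebesgue measure, and so converge setwise along an ultrafilter to
measures `μ i`, which sum to Lebesgue measure and have the masses of the blocks
(`exists_setwise_limit`). A quantile transform on each block gives a measure-preserving map `θ` that
sends the `i`-th block to `μ i` (`exists_isMeasPres_map_restrict`). The entropy of `U^θ` on the block
`I_i × I_j` is then the integral of `h_p (U)` against `μ i × μ j`.

It remains to bound this by the limit of the entropies of `V n`. Products of the measures converge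
setwise, too, and closeness in cut norm says that `V n`, as a density on pairs of points of `U`,
converges to `U` on rectangles, hence on all measurable sets
(`tendsto_setLIntegral_of_rectangles`). Since `h_p` is a supremum of countably many affine functions
(`relEntropy_eq_iSup`), and the integral of an affine function over a set depends only on these two
limits, the bound follows (`lintegral_le_of_iSup_affine`).
-/

open Filter Topology

namespace BlockLDP

/-! ### Setwise limits of measures along an ultrafilter -/

section SetwiseLimit

variable {ι X Y : Type*} [MeasurableSpace X] [MeasurableSpace Y]

theorem exists_tendsto_ennreal (𝒰 : Ultrafilter ι) (f : ι → ℝ≥0∞) :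
    ∃ x, Tendsto f 𝒰 (𝓝 x) := by
  obtain ⟨x, -, hx⟩ := isCompact_univ.ultrafilter_le_nhds (𝒰.map f) (by simp)
  exact ⟨x, hx⟩

/-- Along an ultrafilter, measures with a common finite majorant converge setwise to a measure: the
setwise limit is finitely additive, and being dominated by `m` makes it countably additive. -/
theorem exists_setwise_limit (𝒰 : Ultrafilter ι) (m : Measure X) [IsFiniteMeasure m]
    (μ : ι → Measure X) (hμ : ∀ n, μ n ≤ m) :
    ∃ ν ≤ m, ∀ S, MeasurableSet S → Tendsto (fun n => μ n S) 𝒰 (𝓝 (ν S)) := by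
  choose c hc using fun S => exists_tendsto_ennreal 𝒰 (fun n => μ n S)
  have hcm : ∀ S, c S ≤ m S := fun S =>
    le_of_tendsto (hc S) (Eventually.of_forall fun n => hμ n S)
  have hc0 : c ∅ = 0 := by simpa using hcm ∅
  have hadd : ∀ ⦃f : ℕ → Set X⦄, (∀ i, MeasurableSet (f i)) →
      Pairwise (Function.onFun Disjoint f) → c (⋃ i, f i) = ∑' i, c (f i) := by
    intro f hf hd
    set T : ℕ → Set X := fun N => (⋃ i, f i) \ ⋃ i ∈ Finset.range N, f i with hT
    have hTm : ∀ N, MeasurableSet (T N) := fun N =>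
      (MeasurableSet.iUnion hf).diff (Finset.measurableSet_biUnion _ fun i _ => hf i)
    have hsplit : ∀ N, c (⋃ i, f i) = ∑ i ∈ Finset.range N, c (f i) + c (T N) := by
      intro N
      refine tendsto_nhds_unique (hc _) ?_
      refine ((tendsto_finsetSum (Finset.range N) fun i _ => hc (f i)).add (hc (T N))).congr ?_
      intro n
      rw [← measure_biUnion_finset (fun i _ j _ hij => hd hij) (fun i _ => hf i),
        ← measure_inter_add_sdiff (⋃ i, f i)
          (Finset.measurableSet_biUnion (Finset.range N) fun i _ => hf i), inter_eq_right.2]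
      exact iUnion₂_subset fun i _ => subset_iUnion f i
    have hanti : Antitone T := fun N M h =>
      sdiff_subset_sdiff_right (biUnion_subset_biUnion_left
        (by simpa using h))
    have hempty : ⋂ N, T N = ∅ := by
      refine eq_empty_of_forall_notMem fun x hx => ?_
      obtain ⟨i, hi⟩ := mem_iUnion.1 (mem_iInter.1 hx 0).1
      exact (mem_iInter.1 hx (i + 1)).2 (mem_biUnion (by simp) hi)
    have hT0 : Tendsto (fun N => m (T N)) atTop (𝓝 0) := by
      have := tendsto_measure_iInter_atTop (μ := m) (fun N => (hTm N).nullMeasurableSet) hanti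
        ⟨0, measure_ne_top m _⟩
      rwa [hempty, measure_empty] at this
    have hcT : Tendsto (fun N => c (T N)) atTop (𝓝 0) :=
      tendsto_of_tendsto_of_tendsto_of_le_of_le tendsto_const_nhds hT0 (fun _ => zero_le)
        fun N => hcm _
    have h1 := (ENNReal.tendsto_nat_tsum fun i => c (f i)).add hcT
    rw [add_zero] at h1
    exact tendsto_nhds_unique tendsto_const_nhds (h1.congr fun N => (hsplit N).symm)
  have hν : ∀ S, MeasurableSet S → Measure.ofMeasurable (fun S _ => c S) hc0 hadd S = c S :=
    fun S hS => Measure.ofMeasurable_apply S hS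
  refine ⟨Measure.ofMeasurable (fun S _ => c S) hc0 hadd, ?_, ?_⟩
  · exact Measure.le_intro fun S hS _ => (hν S hS).trans_le (hcm S)
  · intro S hS
    rw [hν S hS]
    exact hc S

/-- Setwise convergence passes to products: by `exists_setwise_limit` the products converge setwise
to some measure, and on rectangles it agrees with the product of the limits. -/
theorem tendsto_prod_of_setwise (𝒰 : Ultrafilter ι) {m : Measure X} {m' : Measure Y}
    [IsFiniteMeasure m] [IsFiniteMeasure m'] {μ : ι → Measure X} {μ' : ι → Measure Y}
    (hμ : ∀ n, μ n ≤ m) (hμ' : ∀ n, μ' n ≤ m') {ν : Measure X} {ν' : Measure Y}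
    (hνm : ν ≤ m) (hνm' : ν' ≤ m')
    (hν : ∀ S, MeasurableSet S → Tendsto (fun n => μ n S) 𝒰 (𝓝 (ν S)))
    (hν' : ∀ S, MeasurableSet S → Tendsto (fun n => μ' n S) 𝒰 (𝓝 (ν' S)))
    {S : Set (X × Y)} (hS : MeasurableSet S) :
    Tendsto (fun n => (μ n).prod (μ' n) S) 𝒰 (𝓝 (ν.prod ν' S)) := by
  have := isFiniteMeasure_of_le m hνm
  have := isFiniteMeasure_of_le m' hνm'
  have hf' : ∀ n, IsFiniteMeasure (μ' n) := fun n => isFiniteMeasure_of_le m' (hμ' n)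
  obtain ⟨κ, -, hκ⟩ := exists_setwise_limit 𝒰 (m.prod m') (fun n => (μ n).prod (μ' n))
    (fun n => Measure.prod_mono (hμ n) (hμ' n))
  have : ν.prod ν' = κ := by
    refine Measure.prod_eq fun s t hs ht => ?_
    refine tendsto_nhds_unique (hκ _ (hs.prod ht)) ?_
    simp only [Measure.prod_prod]
    exact ENNReal.Tendsto.mul (hν s hs) (Or.inr (measure_ne_top _ _)) (hν' t ht)
      (Or.inr (measure_ne_top _ _))
  rw [this]
  exact hκ S hS

/-- A Fatou type inequality for setwise convergence. No measurability of `f` is needed, as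
`∫⁻` is a supremum over simple functions below `f`. -/
theorem lintegral_le_of_setwise {l : Filter ι} [l.NeBot] {μ : ι → Measure X} {ν : Measure X}
    [∀ n, IsFiniteMeasure (μ n)]
    (hν : ∀ S, MeasurableSet S → Tendsto (fun n => μ n S) l (𝓝 (ν S)))
    (f : X → ℝ≥0∞) {c : ℝ≥0∞}
    (hc : Tendsto (fun n => ∫⁻ x, f x ∂(μ n)) l (𝓝 c)) : ∫⁻ x, f x ∂ν ≤ c := by
  rw [lintegral_eq_nnreal]
  refine iSup₂_le fun g hg => ?_
  refine le_of_tendsto_of_tendsto'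
    (f := fun n => (g.map ((↑) : NNReal → ℝ≥0∞)).lintegral (μ n)) ?_ hc fun n => ?_
  · unfold SimpleFunc.lintegral
    refine tendsto_finsetSum _ fun r hr => ?_
    have hr' : r ≠ ⊤ := by
      obtain ⟨x, rfl⟩ := SimpleFunc.mem_range.1 hr
      simp
    exact ENNReal.Tendsto.const_mul (hν _ (SimpleFunc.measurableSet_preimage _ _)) (Or.inr hr')
  · rw [← SimpleFunc.lintegral_eq_lintegral]
    exact lintegral_mono fun x => by simpa using hg x

/-- The Fatou type inequality `lintegral_le_of_setwise` for both `f` and `1 - f` gives convergence,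
because the sums of the two sides have the same limit. Dominated convergence is not available along
an ultrafilter. -/
theorem tendsto_lintegral_of_setwise (𝒰 : Ultrafilter ι) {μ : ι → Measure X} {ν : Measure X}
    [∀ n, IsFiniteMeasure (μ n)] [IsFiniteMeasure ν]
    (hν : ∀ S, MeasurableSet S → Tendsto (fun n => μ n S) 𝒰 (𝓝 (ν S)))
    {f : X → ℝ≥0∞} (hf : Measurable f) (hf1 : ∀ x, f x ≤ 1) :
    Tendsto (fun n => ∫⁻ x, f x ∂(μ n)) 𝒰 (𝓝 (∫⁻ x, f x ∂ν)) := by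
  obtain ⟨a, ha⟩ := exists_tendsto_ennreal 𝒰 (fun n => ∫⁻ x, f x ∂(μ n))
  obtain ⟨b, hb⟩ := exists_tendsto_ennreal 𝒰 (fun n => ∫⁻ x, (1 - f x) ∂(μ n))
  have hsum : ∀ κ : Measure X, ∫⁻ x, f x ∂κ + ∫⁻ x, (1 - f x) ∂κ = κ univ := fun κ => by
    rw [← lintegral_add_left hf]
    simp [add_tsub_cancel_of_le (hf1 _)]
  have hab : a + b = ν univ :=
    tendsto_nhds_unique ((ha.add hb).congr fun n => hsum (μ n)) (hν univ .univ)
  have h1 := lintegral_le_of_setwise hν f ha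
  have h2 := lintegral_le_of_setwise hν _ hb
  have hb' : b ≠ ⊤ := ne_top_of_le_ne_top (measure_ne_top ν univ) (hab ▸ le_add_self)
  have : a = ∫⁻ x, f x ∂ν := by
    refine le_antisymm ?_ h1
    refine (ENNReal.add_le_add_iff_right hb').1 ?_
    rw [hab, ← hsum ν]
    gcongr
  rwa [← this]

end SetwiseLimit

/-! ### Lower semicontinuity for suprema of affine functions -/

section SupAffine

variable {Y Z : Type*} [MeasurableSpace Y] [MeasurableSpace Z]

/-- A superadditive set function that dominates each of countably many measures `f l • ν` dominates
their supremum: partition the space according to which `f l` is the largest. -/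
theorem lintegral_iSup_le_of_superadditive (ν : Measure Y) (η : Set Y → ℝ≥0∞)
    (hη : ∀ S T, MeasurableSet S → MeasurableSet T → Disjoint S T → η S + η T ≤ η (S ∪ T))
    (f : ℕ → Y → ℝ≥0∞) (hf : ∀ l, Measurable (f l))
    (hle : ∀ l S, MeasurableSet S → ∫⁻ y in S, f l y ∂ν ≤ η S) :
    ∫⁻ y, ⨆ l, f l y ∂ν ≤ η univ := by
  have hg : ∀ N, Measurable (partialSups f N) := fun N => by
    induction N with
    | zero => simpa using hf 0
    | succ N ih => rw [partialSups_add_one]; exact ih.sup (hf _)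
  have key : ∀ N S, MeasurableSet S → ∫⁻ y in S, partialSups f N y ∂ν ≤ η S := by
    intro N
    induction N with
    | zero => simpa using hle 0
    | succ N ih =>
      intro S hS
      -- where the new function is not larger the induction hypothesis applies
      set A : Set Y := {y | f (N + 1) y ≤ partialSups f N y}
      have hA : MeasurableSet A := measurableSet_le (hf _) (hg N)
      have hd : Disjoint (S ∩ A) (S \ A) := disjoint_sdiff_inter.symm
      rw [← lintegral_inter_add_sdiff _ S hA]
      calc _ ≤ η (S ∩ A) + η (S \ A) := by
            refine add_le_add ((le_of_eq ?_).trans (ih _ (hS.inter hA)))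
              ((le_of_eq ?_).trans (hle (N + 1) _ (hS.diff hA)))
            · refine setLIntegral_congr_fun (hS.inter hA) fun y hy => ?_
              rw [partialSups_add_one, Pi.sup_apply]
              exact sup_eq_left.2 hy.2
            · refine setLIntegral_congr_fun (hS.diff hA) fun y hy => ?_
              rw [partialSups_add_one, Pi.sup_apply]
              exact sup_eq_right.2 (not_le.1 hy.2).le
        _ ≤ η (S ∩ A ∪ S \ A) := hη _ _ (hS.inter hA) (hS.diff hA) hd
        _ = η S := by rw [inter_union_sdiff]
  have hsup : ∀ y, ⨆ l, f l y = ⨆ N, partialSups f N y := fun y => by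
    rw [← iSup_apply, ← iSup_partialSups_eq f, iSup_apply]
  simp_rw [hsup]
  rw [lintegral_iSup hg fun N M h => (partialSups f).monotone h]
  exact iSup_le fun N => by simpa using key N univ .univ

theorem ofReal_integral_le_lintegral {ν : Measure Y} {f : Y → ℝ} (hf : Integrable f ν) :
    ENNReal.ofReal (∫ y, f y ∂ν) ≤ ∫⁻ y, ENNReal.ofReal (f y) ∂ν := by
  have h := integral_mono hf hf.pos_part fun y => le_max_left (f y) 0
  refine (ENNReal.ofReal_le_ofReal h).trans ?_
  rw [ofReal_integral_eq_lintegral_ofReal hf.pos_part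
    (Eventually.of_forall fun y => le_max_right _ _)]
  exact lintegral_mono fun y => by simp

theorem integrable_of_mem_Icc {ν : Measure Y} [IsFiniteMeasure ν] {f : Y → ℝ}
    (hf : AEMeasurable f ν) (h01 : ∀ y, f y ∈ Icc (0 : ℝ) 1) : Integrable f ν :=
  Integrable.of_mem_Icc 0 1 hf (Eventually.of_forall h01)

theorem setIntegral_affine {ν : Measure Y} [IsFiniteMeasure ν] {f : Y → ℝ} (hf : Measurable f)
    (h01 : ∀ y, f y ∈ Icc (0 : ℝ) 1) (a b : ℝ) (S : Set Y) :
    ∫ y in S, (a * f y + b) ∂ν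
      = a * (∫⁻ y in S, ENNReal.ofReal (f y) ∂ν).toReal + b * (ν S).toReal := by
  have hi : Integrable f (ν.restrict S) := integrable_of_mem_Icc hf.aemeasurable h01
  rw [integral_add (hi.const_mul a) (integrable_const b), integral_const_mul,
    integral_eq_lintegral_of_nonneg_ae (Eventually.of_forall fun y => (h01 y).1)
      hf.aestronglyMeasurable]
  simp [Measure.real, mul_comm]

/-- Lower semicontinuity of `∫⁻ h` for a supremum `h` of countably many affine functions. If the laws
of `f` under `ρ n` converge setwise to `ν`, and the measures with densities `w n`, pushed forward by
`f`, converge setwise to `u • ν`, then `∫⁻ h (u y) ∂ν` is at most the limit of `∫⁻ h (w n z) ∂(ρ n)`.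
Each affine minorant only sees these two limits; `lintegral_iSup_le_of_superadditive`, applied to
the limits `η S` of the integrals over `f ⁻¹' S`, combines the minorants. -/
theorem lintegral_le_of_iSup_affine {ι : Type*} (𝒰 : Ultrafilter ι) {ν : Measure Y}
    [IsFiniteMeasure ν]
    {u : Y → ℝ} (hu : Measurable u) (hu01 : ∀ y, u y ∈ Icc (0 : ℝ) 1)
    {ρ : ι → Measure Z} [∀ n, IsFiniteMeasure (ρ n)] {f : Z → Y} (hf : Measurable f)
    {w : ι → Z → ℝ} (hw : ∀ n, Measurable (w n)) (hw01 : ∀ n z, w n z ∈ Icc (0 : ℝ) 1)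
    (hν : ∀ S, MeasurableSet S → Tendsto (fun n => ρ n (f ⁻¹' S)) 𝒰 (𝓝 (ν S)))
    (hτ : ∀ S, MeasurableSet S →
      Tendsto (fun n => ∫⁻ z in f ⁻¹' S, ENNReal.ofReal (w n z) ∂(ρ n)) 𝒰
        (𝓝 (∫⁻ y in S, ENNReal.ofReal (u y) ∂ν)))
    {h : ℝ → ℝ≥0∞} {a b : ℕ → ℝ}
    (hh : ∀ t ∈ Icc (0 : ℝ) 1, h t = ⨆ l, ENNReal.ofReal (a l * t + b l)) {c : ℝ≥0∞}
    (hc : Tendsto (fun n => ∫⁻ z, h (w n z) ∂(ρ n)) 𝒰 (𝓝 c)) :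
    ∫⁻ y, h (u y) ∂ν ≤ c := by
  choose η hη using fun S : Set Y =>
    exists_tendsto_ennreal 𝒰 (fun n => ∫⁻ z in f ⁻¹' S, h (w n z) ∂(ρ n))
  have hηu : η univ = c := tendsto_nhds_unique (hη univ) (by simpa using hc)
  have hηmono : ∀ S T, S ⊆ T → η S ≤ η T := fun S T hST =>
    le_of_tendsto_of_tendsto' (hη S) (hη T) fun n => lintegral_mono_set (preimage_mono hST)
  simp_rw [fun y => hh (u y) (hu01 y)]
  rw [← hηu]
  refine lintegral_iSup_le_of_superadditive ν η ?_ _ (fun l => by fun_prop) ?_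
  · intro S T hS hT hd
    refine le_of_tendsto_of_tendsto' ((hη S).add (hη T)) (hη (S ∪ T)) fun n => ?_
    rw [preimage_union, lintegral_union (hf hT) (hd.preimage f)]
  · intro l S hS
    -- restricted to where the affine minorant is non-negative, truncation at `0` does nothing
    set P : Set Y := S ∩ {y | 0 ≤ a l * u y + b l} with hP
    have hPm : MeasurableSet P :=
      hS.inter (measurableSet_le measurable_const (by fun_prop))
    have h1 : ∫⁻ y in S, ENNReal.ofReal (a l * u y + b l) ∂ν
        = ENNReal.ofReal (∫ y in P, (a l * u y + b l) ∂ν) := by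
      rw [ofReal_integral_eq_lintegral_ofReal]
      · rw [← lintegral_inter_add_sdiff _ S
          (measurableSet_le (f := fun _ => (0 : ℝ)) (g := fun y => a l * u y + b l)
            measurable_const (by fun_prop))]
        convert add_zero _
        refine (setLIntegral_congr_fun (g := fun _ => 0) ?_ fun y hy => ?_).trans (by simp)
        · exact hS.diff (measurableSet_le measurable_const (by fun_prop))
        · exact ENNReal.ofReal_of_nonpos (not_le.1 hy.2).le
      · exact ((integrable_of_mem_Icc hu.aemeasurable hu01).const_mul _).add (integrable_const _)
      · exact (ae_restrict_iff' hPm).2 (Eventually.of_forall fun y hy => hy.2)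
    have hle1 : ∀ t ∈ Icc (0 : ℝ) 1, ENNReal.ofReal (a l * t + b l) ≤ h t := fun t ht => by
      rw [hh t ht]
      exact le_iSup (fun l => ENNReal.ofReal (a l * t + b l)) l
    rw [h1]
    refine le_trans ?_ (hηmono P S inter_subset_left)
    refine le_of_tendsto_of_tendsto' ?_ (hη P)
      (f := fun n => ENNReal.ofReal (∫ z in f ⁻¹' P, (a l * w n z + b l) ∂(ρ n))) fun n => ?_
    · refine (ENNReal.continuous_ofReal.tendsto _).comp ?_
      simp_rw [setIntegral_affine (hw _) (hw01 _), setIntegral_affine hu hu01]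
      have hfin : ∀ {W : Type _} [MeasurableSpace W] (κ : Measure W) [IsFiniteMeasure κ]
          (g : W → ℝ), (∀ x, g x ∈ Icc (0 : ℝ) 1) → ∀ S : Set W,
          ∫⁻ x in S, ENNReal.ofReal (g x) ∂κ ≠ ⊤ := by
        intro W _ κ _ g hg S
        refine ne_top_of_le_ne_top (measure_ne_top (κ.restrict S) univ) ?_
        rw [← lintegral_one]
        exact lintegral_mono fun x => by simpa using (hg x).2
      refine (Tendsto.const_mul _ ?_).add (Tendsto.const_mul _ ?_)
      · exact (ENNReal.tendsto_toReal (hfin ν u hu01 P)).comp (hτ P hPm)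
      · exact (ENNReal.tendsto_toReal (measure_ne_top ν P)).comp (hν P hPm)
    · refine (ofReal_integral_le_lintegral ?_).trans
        (lintegral_mono fun z => hle1 _ (hw01 n z))
      exact ((integrable_of_mem_Icc (hw n).aemeasurable (hw01 n)).const_mul _).add
        (integrable_const _)

end SupAffine

/-! ### Dominated measures, push-forwards and gluing -/

section Lifting

variable {T X : Type*} [MeasurableSpace T] [MeasurableSpace X]

theorem withDensity_ofReal_le (m : Measure X) {f : X → ℝ} (h01 : ∀ x, f x ∈ Icc (0 : ℝ) 1) :
    m.withDensity (fun x => ENNReal.ofReal (f x)) ≤ m :=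
  calc _ ≤ m.withDensity 1 :=
        withDensity_mono (Eventually.of_forall fun x => by simpa using (h01 x).2)
    _ = m := withDensity_one

/-- A measure below `m` has a density with values in `[0,1]` everywhere. -/
theorem exists_withDensity_of_le {m μ : Measure X} [IsFiniteMeasure m] (h : μ ≤ m) :
    ∃ g : X → ℝ, Measurable g ∧ (∀ x, g x ∈ Icc (0 : ℝ) 1) ∧
      μ = m.withDensity fun x => ENNReal.ofReal (g x) := by
  have := isFiniteMeasure_of_le m h
  refine ⟨fun x => min (μ.rnDeriv m x).toReal 1,
    (Measure.measurable_rnDeriv μ m).ennreal_toReal.min measurable_const,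
    fun x => ⟨le_min ENNReal.toReal_nonneg zero_le_one, min_le_right _ _⟩, ?_⟩
  conv_lhs => rw [← Measure.withDensity_rnDeriv_eq μ m (Measure.absolutelyContinuous_of_le h)]
  refine withDensity_congr_ae ?_
  filter_upwards [Measure.rnDeriv_le_one_of_le h] with x hx
  have hx' : μ.rnDeriv m x ≠ ⊤ := ne_top_of_le_ne_top ENNReal.one_ne_top hx
  rw [min_eq_left (by simpa using ENNReal.toReal_mono ENNReal.one_ne_top hx),
    ENNReal.ofReal_toReal hx']

/-- Measures below a push-forward lift to measures below the original one. -/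
theorem exists_le_map_eq {m : Measure T} [IsFiniteMeasure m] {r : T → X} (hr : Measurable r)
    {μ : Measure X} (h : μ ≤ m.map r) : ∃ μ' ≤ m, μ'.map r = μ := by
  obtain ⟨g, hg, hg01, rfl⟩ := exists_withDensity_of_le h
  refine ⟨m.withDensity fun t => ENNReal.ofReal (g (r t)), ?_, ?_⟩
  · exact withDensity_ofReal_le m fun t => hg01 (r t)
  · ext S hS
    rw [Measure.map_apply hr hS, withDensity_apply _ (hr hS), withDensity_apply _ hS,
      setLIntegral_map hS (by fun_prop) hr]

/-- Two measures with a common marginal on `A` are marginals of one measure on `A × B × C`: make the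
two other coordinates conditionally independent given the first. -/
theorem exists_gluing {A B C : Type*} [MeasurableSpace A] [MeasurableSpace B] [MeasurableSpace C]
    [StandardBorelSpace B] [Nonempty B] [StandardBorelSpace C] [Nonempty C]
    (ρ : Measure (A × B)) (ρ' : Measure (A × C)) [IsFiniteMeasure ρ] [IsFiniteMeasure ρ']
    (h : ρ.fst = ρ'.fst) :
    ∃ m : Measure (A × B × C), IsFiniteMeasure m ∧ m.map (fun t => (t.1, t.2.1)) = ρ ∧
      m.map (fun t => (t.1, t.2.2)) = ρ' := by
  refine ⟨ρ.fst.compProd (ρ.condKernel.prod ρ'.condKernel), inferInstance, ?_, ?_⟩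
  · conv_rhs => rw [← ρ.disintegrate ρ.condKernel]
    ext S hS
    rw [Measure.map_apply (by fun_prop) hS, Measure.compProd_apply hS,
      Measure.compProd_apply (hS.preimage (by fun_prop))]
    refine lintegral_congr fun a => ?_
    rw [ProbabilityTheory.Kernel.prod_apply]
    have : Prod.mk a ⁻¹' ((fun t : A × B × C => (t.1, t.2.1)) ⁻¹' S)
        = (Prod.mk a ⁻¹' S) ×ˢ univ := by ext; simp
    rw [this, Measure.prod_prod]
    simp
  · conv_rhs => rw [← ρ'.disintegrate ρ'.condKernel, ← h]
    ext S hS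
    rw [Measure.map_apply (by fun_prop) hS, Measure.compProd_apply hS,
      Measure.compProd_apply (hS.preimage (by fun_prop))]
    refine lintegral_congr fun a => ?_
    rw [ProbabilityTheory.Kernel.prod_apply]
    have : Prod.mk a ⁻¹' ((fun t : A × B × C => (t.1, t.2.2)) ⁻¹' S)
        = univ ×ˢ (Prod.mk a ⁻¹' S) := by ext; simp
    rw [this, Measure.prod_prod]
    simp

end Lifting

/-! ### Couplings that are close in cut norm -/

section Coupling

/-- There is a coupling `π` of Lebesgue measure with itself under which `u`, read off the first
coordinates, and `v`, read off the second ones, are within `ε` in a cut norm. In place of the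
rectangles `A × B` of the cut norm there are products of measures below `π`, that is,
`[0,1]`-valued weights: this form passes to extensions of `π` without conditioning. -/
def CouplingClose (u v : I × I → ℝ) (ε : ℝ) : Prop :=
  ∃ π : Measure (I × I), π.map Prod.fst = volume ∧ π.map Prod.snd = volume ∧
    ∀ μ₁ μ₂ : Measure (I × I), μ₁ ≤ π → μ₂ ≤ π →
      |∫ w, (u (w.1.1, w.2.1) - v (w.1.2, w.2.2)) ∂(μ₁.prod μ₂)| ≤ ε

theorem isProbabilityMeasure_of_map_fst {π : Measure (I × I)} (h : π.map Prod.fst = volume) :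
    IsProbabilityMeasure π := by
  constructor
  have := congrArg (fun μ => μ univ) h
  simpa [Measure.map_apply measurable_fst] using this

theorem CouplingClose.symm {u v : I × I → ℝ} {ε : ℝ} (h : CouplingClose u v ε) :
    CouplingClose v u ε := by
  obtain ⟨π, h1, h2, hπ⟩ := h
  have := isProbabilityMeasure_of_map_fst h1
  refine ⟨π.map Prod.swap, ?_, ?_, fun μ₁ μ₂ hμ₁ hμ₂ => ?_⟩
  · rwa [Measure.map_map measurable_fst measurable_swap]
  · rwa [Measure.map_map measurable_snd measurable_swap]
  · obtain ⟨ν₁, hν₁, rfl⟩ := exists_le_map_eq measurable_swap hμ₁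
    obtain ⟨ν₂, hν₂, rfl⟩ := exists_le_map_eq measurable_swap hμ₂
    have := isFiniteMeasure_of_le π hν₁
    have := isFiniteMeasure_of_le π hν₂
    have e : MeasurableEmbedding
        (Prod.map (Prod.swap (α := I) (β := I)) (Prod.swap (α := I) (β := I))) :=
      (MeasurableEquiv.prodComm.prodCongr MeasurableEquiv.prodComm).measurableEmbedding
    rw [Measure.map_prod_map _ _ measurable_swap measurable_swap, e.integral_map, ← abs_neg,
      ← integral_neg]
    simpa using hπ ν₁ ν₂ hν₁ hν₂

/-- The triangle inequality for couplings, by gluing along the middle coordinate. -/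
theorem CouplingClose.trans {u v w : I × I → ℝ} (hu : Measurable u) (hv : Measurable v)
    (hw : Measurable w) (hu01 : ∀ z, u z ∈ Icc (0 : ℝ) 1) (hv01 : ∀ z, v z ∈ Icc (0 : ℝ) 1)
    (hw01 : ∀ z, w z ∈ Icc (0 : ℝ) 1) {ε δ : ℝ} (h : CouplingClose u v ε)
    (h' : CouplingClose v w δ) : CouplingClose u w (ε + δ) := by
  obtain ⟨π, hπ1, hπ2, hπ⟩ := h
  obtain ⟨π', hπ1', hπ2', hπ'⟩ := h'
  have := isProbabilityMeasure_of_map_fst hπ1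
  have := isProbabilityMeasure_of_map_fst hπ1'
  obtain ⟨m, hm, hm1, hm2⟩ := exists_gluing (π.map Prod.swap) π' (by
    rw [Measure.fst, Measure.fst, Measure.map_map measurable_fst measurable_swap, hπ1']
    exact hπ2)
  -- `m` lives on triples `(y, x, z)`, with `π` the law of `(x, y)` and `π'` that of `(y, z)`
  set q : I × I × I → I × I := fun t => (t.2.1, t.1)
  set q' : I × I × I → I × I := fun t => (t.1, t.2.2)
  have hq : Measurable q := by fun_prop
  have hq' : Measurable q' := by fun_prop
  have hm1' : m.map q = π := by
    have := congrArg (Measure.map Prod.swap) hm1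
    rwa [Measure.map_map measurable_swap (by fun_prop), Measure.map_map measurable_swap
      measurable_swap, Prod.swap_swap_eq, Measure.map_id] at this
  refine ⟨m.map fun t => (t.2.1, t.2.2), ?_, ?_, fun μ₁ μ₂ hμ₁ hμ₂ => ?_⟩
  · rw [Measure.map_map measurable_fst (by fun_prop), ← hπ1, ← hm1',
      Measure.map_map measurable_fst hq]
    rfl
  · rw [Measure.map_map measurable_snd (by fun_prop), ← hπ2', ← hm2,
      Measure.map_map measurable_snd (by fun_prop)]
    rfl
  · obtain ⟨ν₁, hν₁, rfl⟩ := exists_le_map_eq (by fun_prop) hμ₁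
    obtain ⟨ν₂, hν₂, rfl⟩ := exists_le_map_eq (by fun_prop) hμ₂
    have := isFiniteMeasure_of_le m hν₁
    have := isFiniteMeasure_of_le m hν₂
    have e1 := hπ (ν₁.map q) (ν₂.map q) (hm1' ▸ Measure.map_mono hν₁ hq)
      (hm1' ▸ Measure.map_mono hν₂ hq)
    have e2 := hπ' (ν₁.map q') (ν₂.map q') (hm2 ▸ Measure.map_mono hν₁ hq')
      (hm2 ▸ Measure.map_mono hν₂ hq')
    rw [Measure.map_prod_map _ _ (by fun_prop) (by fun_prop),
      integral_map (by fun_prop) (Measurable.aestronglyMeasurable (by fun_prop))] at e1 e2 ⊢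
    have hi : ∀ {g : I × I → ℝ} (_ : Measurable g) (_ : ∀ z, g z ∈ Icc (0 : ℝ) 1)
        {p : (I × I × I) × (I × I × I) → I × I} (_ : Measurable p),
        Integrable (fun t => g (p t)) (ν₁.prod ν₂) := fun hg hg01 p hp =>
      integrable_of_mem_Icc (hg.comp hp).aemeasurable fun t => hg01 _
    refine le_trans (le_of_eq ?_) ((abs_add_le _ _).trans (add_le_add e1 e2))
    rw [← integral_add]
    · congr 1
      refine integral_congr_ae (Eventually.of_forall fun t => ?_)
      simp [q, q']
    · exact (hi hu hu01 (by fun_prop)).sub (hi hv hv01 (by fun_prop))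
    · exact (hi hv hv01 (by fun_prop)).sub (hi hw hw01 (by fun_prop))

/-- A bound on integrals over rectangles is a bound for `[0,1]`-valued weights: write the weights
`f` and `g` as averages of indicators of `{s < f}` and `{t < g}` over `s, t ∈ [0,1]`. -/
theorem abs_integral_prod_le_of_rectangles {W : I × I → ℝ} (hW : AEMeasurable W volume)
    (hW1 : ∀ z, |W z| ≤ 1) {ε : ℝ}
    (h : ∀ A B : Set I, MeasurableSet A → MeasurableSet B → |∫ z in A ×ˢ B, W z| ≤ ε)
    {μ₁ μ₂ : Measure I} (h1 : μ₁ ≤ volume) (h2 : μ₂ ≤ volume) :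
    |∫ z, W z ∂(μ₁.prod μ₂)| ≤ ε := by
  obtain ⟨f, hf, hf01, rfl⟩ := exists_withDensity_of_le h1
  obtain ⟨g, hg, hg01, rfl⟩ := exists_withDensity_of_le h2
  rw [prod_withDensity (by fun_prop) (by fun_prop),
    integral_withDensity_eq_integral_toReal_smul (by fun_prop)
      (Eventually.of_forall fun z =>
        ENNReal.mul_lt_top ENNReal.ofReal_lt_top ENNReal.ofReal_lt_top)]
  have hvol : ∀ r ∈ Icc (0 : ℝ) 1, ∫ s : I, (Iio r).indicator (fun _ => (1 : ℝ)) (s : ℝ) = r := by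
    intro r hr
    have : (fun s : I => (Iio r).indicator (fun _ => (1 : ℝ)) (s : ℝ))
        = (Iio (⟨r, hr⟩ : I)).indicator fun _ => 1 := by
      ext s
      by_cases hs : (s : ℝ) < r
      · rw [indicator_of_mem (by exact hs), indicator_of_mem (by exact hs)]
      · rw [indicator_of_notMem (by exact hs), indicator_of_notMem (by exact hs)]
    rw [this, integral_indicator_const _ measurableSet_Iio]
    simp [Measure.real, hr.1]
  -- averaging `K z` over thresholds gives the weighted value of `W` at `z`, while for fixed
  -- thresholds `K` is `W` restricted to a rectangle
  set K : I × I → I × I → ℝ := fun z st =>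
    (Iio (f z.1)).indicator (fun _ => (1 : ℝ)) (st.1 : ℝ)
      * (Iio (g z.2)).indicator (fun _ => (1 : ℝ)) (st.2 : ℝ) * W z with hK
  have hKint : ∀ z : I × I, (ENNReal.ofReal (f z.1) * ENNReal.ofReal (g z.2)).toReal • W z
      = ∫ st, K z st := by
    intro z
    rw [integral_mul_const, ENNReal.toReal_mul, ENNReal.toReal_ofReal (hf01 _).1,
      ENNReal.toReal_ofReal (hg01 _).1, smul_eq_mul]
    congr 1
    have := integral_prod_mul (μ := (volume : Measure I)) (ν := (volume : Measure I))
      (fun s : I => (Iio (f z.1)).indicator (fun _ => (1 : ℝ)) (s : ℝ))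
      (fun s : I => (Iio (g z.2)).indicator (fun _ => (1 : ℝ)) (s : ℝ))
    rw [hvol _ (hf01 z.1), hvol _ (hg01 z.2)] at this
    exact this.symm
  simp_rw [hKint]
  have hind : ∀ r s : ℝ, |(Iio r).indicator (fun _ => (1 : ℝ)) s| ≤ 1 := fun r s => by
    by_cases hs : s < r
    · rw [indicator_of_mem (by exact hs)]; simp
    · rw [indicator_of_notMem (by exact hs)]; simp
  have hmeas : ∀ {k : I → ℝ} (_ : Measurable k), Measurable fun p : I × I =>
      (Iio (k p.1)).indicator (fun _ => (1 : ℝ)) (p.2 : ℝ) := by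
    intro k hk
    have : (fun p : I × I => (Iio (k p.1)).indicator (fun _ => (1 : ℝ)) (p.2 : ℝ))
        = {p : I × I | (p.2 : ℝ) < k p.1}.indicator fun _ => 1 := by
      ext p
      by_cases hs : (p.2 : ℝ) < k p.1
      · rw [indicator_of_mem (by exact hs), indicator_of_mem (by exact hs)]
      · rw [indicator_of_notMem (by exact hs), indicator_of_notMem (by exact hs)]
    rw [this]
    exact measurable_const.indicator (measurableSet_lt (by fun_prop) (by fun_prop))
  have hKi : Integrable (Function.uncurry K) ((volume : Measure (I × I)).prod volume) := by
    refine Integrable.of_bound (C := 1) ?_ (Eventually.of_forall fun p => ?_)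
    · have h1 := (hmeas hf).comp
        (show Measurable fun p : (I × I) × (I × I) => (p.1.1, p.2.1) by fun_prop)
      have h2 := (hmeas hg).comp
        (show Measurable fun p : (I × I) × (I × I) => (p.1.2, p.2.2) by fun_prop)
      exact ((h1.mul h2).aemeasurable.mul
        (hW.comp_quasiMeasurePreserving Measure.quasiMeasurePreserving_fst)).aestronglyMeasurable
    · rw [Real.norm_eq_abs]
      simp only [Function.uncurry, hK, abs_mul]
      exact mul_le_one₀ (mul_le_one₀ (hind _ _) (abs_nonneg _) (hind _ _)) (abs_nonneg _) (hW1 _)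
  rw [← Measure.volume_eq_prod, integral_integral_swap hKi]
  have := norm_integral_le_of_norm_le_const (μ := (volume : Measure (I × I)))
    (f := fun st => ∫ z, K z st) (C := ε) (Eventually.of_forall fun st => ?_)
  · simpa using this
  · have hset : (fun z => K z st)
        = ({x | (st.1 : ℝ) < f x} ×ˢ {y | (st.2 : ℝ) < g y}).indicator W := by
      ext z
      by_cases h1 : (st.1 : ℝ) < f z.1
      · by_cases h2 : (st.2 : ℝ) < g z.2
        · rw [indicator_of_mem (s := _ ×ˢ _) ⟨h1, h2⟩]
          simp [hK, h1, h2]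
        · rw [indicator_of_notMem (s := _ ×ˢ _) fun h => h2 h.2]
          simp [hK, h2]
      · rw [indicator_of_notMem (s := _ ×ˢ _) fun h => h1 h.1]
        simp [hK, h1]
    have hA : MeasurableSet {x | (st.1 : ℝ) < f x} := measurableSet_lt measurable_const hf
    have hB : MeasurableSet {y | (st.2 : ℝ) < g y} := measurableSet_lt measurable_const hg
    rw [hset, integral_indicator (hA.prod hB), Real.norm_eq_abs]
    exact h _ _ hA hB

end Coupling

/-! ### From the cut-distance to couplings -/

section CutDist

theorem Graphon.abs_sub_le_one (U V : Graphon) (z z' : I × I) :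
    |U.toFun z - V.toFun z'| ≤ 1 := by
  have h1 := U.mem_Icc z
  have h2 := V.mem_Icc z'
  rw [abs_le]
  constructor <;> linarith [h1.1, h1.2, h2.1, h2.2]

theorem abs_setIntegral_le_cutNormDist (U V : Graphon) {A B : Set I} (hA : MeasurableSet A)
    (hB : MeasurableSet B) :
    |∫ z in A ×ˢ B, (U.toFun z - V.toFun z)| ≤ cutNormDist U V := by
  refine le_csSup ⟨1, ?_⟩ ⟨A, B, hA.nullMeasurableSet, hB.nullMeasurableSet, rfl⟩
  rintro _ ⟨A, B, -, -, rfl⟩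
  have := norm_setIntegral_le_of_norm_le_const (μ := (volume : Measure (I × I))) (s := A ×ˢ B)
    (f := fun z => U.toFun z - V.toFun z) (C := 1) (measure_lt_top _ _)
    (fun z _ => by rw [Real.norm_eq_abs]; exact Graphon.abs_sub_le_one U V z z)
  rw [Real.norm_eq_abs, one_mul] at this
  exact this.trans measureReal_le_one

theorem cutNormDist_nonneg (U V : Graphon) : 0 ≤ cutNormDist U V :=
  (abs_nonneg _).trans (abs_setIntegral_le_cutNormDist U V MeasurableSet.univ MeasurableSet.univ)

theorem cutNormDist_self (U : Graphon) : cutNormDist U U = 0 := by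
  refine le_antisymm (csSup_le ⟨_, ∅, ∅, by simp, by simp, rfl⟩ ?_) (cutNormDist_nonneg U U)
  rintro _ ⟨A, B, -, -, rfl⟩
  simp

theorem cutDist_le (U V : Graphon) {φ ψ : I → I} (hφ : IsMeasPres φ) (hψ : IsMeasPres ψ) :
    cutDist U V ≤ cutNormDist (U.pullback φ hφ) (V.pullback ψ hψ) :=
  csInf_le ⟨0, by rintro _ ⟨φ, ψ, hφ, hψ, rfl⟩; exact cutNormDist_nonneg _ _⟩
    ⟨φ, ψ, hφ, hψ, rfl⟩

theorem cutDist_nonneg (U V : Graphon) : 0 ≤ cutDist U V :=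
  Real.sInf_nonneg (by rintro _ ⟨φ, ψ, hφ, hψ, rfl⟩; exact cutNormDist_nonneg _ _)

theorem cutDist_pullback (U : Graphon) {θ : I → I} (hθ : IsMeasPres θ) :
    cutDist U (U.pullback θ hθ) = 0 := by
  refine le_antisymm ?_ (cutDist_nonneg _ _)
  refine (cutDist_le U (U.pullback θ hθ) hθ IsMeasPres.id).trans_eq ?_
  exact cutNormDist_self (U.pullback θ hθ)

theorem cutDist_self (U : Graphon) : cutDist U U = 0 :=
  cutDist_pullback U IsMeasPres.id

/-- A graphon agrees almost everywhere with a Borel function with values in `[0,1]`. -/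
theorem Graphon.exists_measurable_rep (U : Graphon) :
    ∃ u : I × I → ℝ, Measurable u ∧ (∀ z, u z ∈ Icc (0 : ℝ) 1) ∧ U.toFun =ᵐ[volume] u := by
  refine ⟨fun z => max 0 (min (U.aemeasurable.mk _ z) 1),
    measurable_const.max (U.aemeasurable.measurable_mk.min measurable_const),
    fun z => ⟨le_max_left _ _, max_le zero_le_one (min_le_right _ _)⟩, ?_⟩
  filter_upwards [U.aemeasurable.ae_eq_mk] with z hz
  rw [← hz, min_eq_left (U.mem_Icc z).2, max_eq_right (U.mem_Icc z).1]

/-- The coupling is the law of `(φ x, ψ x)` for maps `φ`, `ψ` that nearly attain the cut-distance. -/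
theorem couplingClose_of_cutDist_lt {U V : Graphon} {u v : I × I → ℝ} (hu : Measurable u)
    (hv : Measurable v) (hUu : U.toFun =ᵐ[volume] u) (hVv : V.toFun =ᵐ[volume] v) {ε : ℝ}
    (h : cutDist U V < ε) : CouplingClose u v ε := by
  obtain ⟨_, ⟨φ, ψ, hφ, hψ, rfl⟩, hlt⟩ := exists_lt_of_csInf_lt
    (by exact ⟨_, fun x => x, fun x => x, IsMeasPres.id, IsMeasPres.id, rfl⟩) h
  have hmφ := hφ.aemeasurable.measurable_mk
  have hmψ := hψ.aemeasurable.measurable_mk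
  have heφ := hφ.aemeasurable.ae_eq_mk
  have heψ := hψ.aemeasurable.ae_eq_mk
  set φ' := hφ.aemeasurable.mk φ
  set ψ' := hψ.aemeasurable.mk ψ
  have hpair : Measurable fun x => (φ' x, ψ' x) := hmφ.prodMk hmψ
  -- the pull-backs agree almost everywhere with the pull-backs of the measurable versions
  have hae : ∀ {X : Graphon} {x : I × I → ℝ} {θ θ' : I → I} (_ : X.toFun =ᵐ[volume] x)
      (_ : IsMeasPres θ) (_ : θ =ᵐ[volume] θ'),
      ∀ᵐ z ∂(volume : Measure (I × I)), X.toFun (θ z.1, θ z.2) = x (θ' z.1, θ' z.2) := by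
    intro X x θ θ' hXx hθ hθ'
    have h1 : ∀ᵐ z ∂(volume : Measure (I × I)), X.toFun (Prod.map θ θ z) = x (Prod.map θ θ z) := by
      have h2 := hθ.prodMap
      refine ae_of_ae_map (f := Prod.map θ θ) (p := fun z => X.toFun z = x z) h2.1 ?_
      rw [h2.2]
      exact hXx
    filter_upwards [h1, Measure.quasiMeasurePreserving_fst.ae hθ',
      Measure.quasiMeasurePreserving_snd.ae hθ'] with z hz h3 h4
    rw [← h3, ← h4]
    exact hz
  refine ⟨volume.map fun x => (φ' x, ψ' x), ?_, ?_, fun μ₁ μ₂ hμ₁ hμ₂ => ?_⟩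
  · rw [Measure.map_map measurable_fst hpair]
    exact (Measure.map_congr heφ.symm).trans hφ.map_eq
  · rw [Measure.map_map measurable_snd hpair]
    exact (Measure.map_congr heψ.symm).trans hψ.map_eq
  · obtain ⟨ν₁, hν₁, rfl⟩ := exists_le_map_eq hpair hμ₁
    obtain ⟨ν₂, hν₂, rfl⟩ := exists_le_map_eq hpair hμ₂
    have := isFiniteMeasure_of_le _ hν₁
    have := isFiniteMeasure_of_le _ hν₂
    rw [Measure.map_prod_map _ _ hpair hpair,
      integral_map (by fun_prop) (Measurable.aestronglyMeasurable (by fun_prop))]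
    have hac : ν₁.prod ν₂ ≪ (volume : Measure (I × I)) :=
      Measure.absolutelyContinuous_of_le (Measure.prod_mono hν₁ hν₂)
    have hcongr : ∫ z, ((U.pullback φ hφ).toFun z - (V.pullback ψ hψ).toFun z) ∂(ν₁.prod ν₂)
        = ∫ z, (u (φ' z.1, φ' z.2) - v (ψ' z.1, ψ' z.2)) ∂(ν₁.prod ν₂) := by
      refine integral_congr_ae ?_
      filter_upwards [hac.ae_le (hae hUu hφ heφ), hac.ae_le (hae hVv hψ heψ)] with z h1 h2
      simp only [Graphon.pullback]
      rw [h1, h2]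
    simp only [Prod.map_fst, Prod.map_snd]
    rw [← hcongr]
    exact abs_integral_prod_le_of_rectangles
      ((U.pullback φ hφ).aemeasurable.sub (V.pullback ψ hψ).aemeasurable)
      (fun z => Graphon.abs_sub_le_one _ _ z z)
      (fun A B hA hB => (abs_setIntegral_le_cutNormDist _ _ hA hB).trans hlt.le) hν₁ hν₂

end CutDist

/-! ### Block intervals and their quantile transforms -/

section Blocks

variable {k : ℕ} {α : Fin k → ℝ}

theorem sum_pos_of_ne_zero (hα : ∀ i, 0 ≤ α i) (hα0 : α ≠ 0) : 0 < ∑ j, α j := by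
  refine (Finset.sum_nonneg fun i _ => hα i).lt_of_ne' fun h => hα0 ?_
  ext i
  exact (Finset.sum_eq_zero_iff_of_nonneg fun i _ => hα i).1 h i (Finset.mem_univ i)

theorem measurableSet_blockInterval (i : Fin k) : MeasurableSet (blockInterval α i) := by
  refine (measurableSet_le measurable_const measurable_subtype_coe).inter ?_
  exact (measurableSet_lt measurable_subtype_coe measurable_const).union (MeasurableSet.const _)

theorem sum_Iic_div_eq (i : Fin k) : (∑ j ∈ Finset.Iic i, α j) / ∑ j, α j
    = (∑ j ∈ Finset.Iio i, α j) / ∑ j, α j + α i / ∑ j, α j := by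
  rw [← Finset.Iio_insert, Finset.sum_insert (by simp), add_div, add_comm]

theorem sum_Iic_div_le_one (hα : ∀ i, 0 ≤ α i) (i : Fin k) :
    (∑ j ∈ Finset.Iic i, α j) / ∑ j, α j ≤ 1 :=
  div_le_one_of_le₀ (Finset.sum_le_sum_of_subset_of_nonneg (Finset.subset_univ _)
    fun j _ _ => hα j) (Finset.sum_nonneg fun j _ => hα j)

theorem sum_Iic_div_eq_one (hα : ∀ i, 0 ≤ α i) (hα0 : α ≠ 0) {i : Fin k} (hi : (i : ℕ) + 1 = k) :
    (∑ j ∈ Finset.Iic i, α j) / ∑ j, α j = 1 := by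
  have : Finset.Iic i = Finset.univ := by
    ext j
    simp only [Finset.mem_Iic, Finset.mem_univ, iff_true, Fin.le_def]
    omega
  rw [this, div_self (sum_pos_of_ne_zero hα hα0).ne']

theorem le_of_mem_blockInterval (hα : ∀ i, 0 ≤ α i) (hα0 : α ≠ 0) {i : Fin k} {x : I}
    (hx : x ∈ blockInterval α i) : (x : ℝ) ≤ (∑ j ∈ Finset.Iic i, α j) / ∑ j, α j := by
  rcases hx.2 with h | h
  · exact h.le
  · rw [sum_Iic_div_eq_one hα hα0 h]
    exact x.2.2

theorem pairwise_disjoint_blockInterval (hα : ∀ i, 0 ≤ α i) :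
    Pairwise (Function.onFun Disjoint (blockInterval α)) := by
  have key : ∀ i j : Fin k, i < j → Disjoint (blockInterval α i) (blockInterval α j) := by
    intro i j hij
    refine disjoint_left.2 fun x hi hj => ?_
    have h1 : (x : ℝ) < (∑ l ∈ Finset.Iic i, α l) / ∑ l, α l :=
      hi.2.resolve_right (by have := j.2; have : (i : ℕ) < j := hij; omega)
    have h2 : (∑ l ∈ Finset.Iic i, α l) / ∑ l, α l ≤ (∑ l ∈ Finset.Iio j, α l) / ∑ l, α l :=
      div_le_div_of_nonneg_right (Finset.sum_le_sum_of_subset_of_nonneg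
        (fun l hl => by simp only [Finset.mem_Iic, Finset.mem_Iio] at *; exact hl.trans_lt hij)
        fun l _ _ => hα l) (Finset.sum_nonneg fun l _ => hα l)
    linarith [hj.1]
  intro i j hij
  rcases lt_or_gt_of_ne hij with h | h
  · exact key i j h
  · exact (key j i h).symm

theorem exists_mem_blockInterval (hα0 : α ≠ 0) (x : I) : ∃ i, x ∈ blockInterval α i := by
  have hk : 0 < k := Nat.pos_of_ne_zero (by rintro rfl; exact hα0 (Subsingleton.elim _ _))
  set s : Finset (Fin k) :=
    Finset.univ.filter fun i => (∑ j ∈ Finset.Iio i, α j) / ∑ j, α j ≤ (x : ℝ) with hs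
  have h0 : (⟨0, hk⟩ : Fin k) ∈ s := by
    have : Finset.Iio (⟨0, hk⟩ : Fin k) = ∅ := by
      ext j
      simp [Fin.lt_def]
    simp [hs, this, x.2.1]
  set i := s.max' ⟨_, h0⟩ with hi
  have his : i ∈ s := s.max'_mem _
  refine ⟨i, (Finset.mem_filter.1 his).2, ?_⟩
  by_cases hlast : (i : ℕ) + 1 = k
  · exact Or.inr hlast
  · left
    have hlt : (i : ℕ) + 1 < k := by have := i.2; omega
    have hIio : Finset.Iio (⟨i + 1, hlt⟩ : Fin k) = Finset.Iic i := by
      ext j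
      simp only [Finset.mem_Iio, Finset.mem_Iic, Fin.lt_def, Fin.le_def]
      omega
    by_contra! hcon
    have hmem : (⟨i + 1, hlt⟩ : Fin k) ∈ s := by
      simp only [hs, Finset.mem_filter, Finset.mem_univ, true_and]
      rwa [hIio]
    have := s.le_max' _ hmem
    rw [← hi, Fin.le_def] at this
    simp at this

theorem iUnion_blockInterval (hα0 : α ≠ 0) : ⋃ i, blockInterval α i = univ :=
  eq_univ_of_forall fun x => mem_iUnion.2 (exists_mem_blockInterval hα0 x)

theorem sum_measure_inter {X : Type*} [MeasurableSpace X] (m : Measure X) {B : Fin k → Set X}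
    (hB : ∀ i, MeasurableSet (B i)) (hd : Pairwise (Function.onFun Disjoint B))
    (hU : ⋃ i, B i = univ) {S : Set X} (hS : MeasurableSet S) : ∑ i, m (S ∩ B i) = m S := by
  conv_rhs => rw [← inter_univ S, ← hU, inter_iUnion]
  rw [measure_iUnion (fun i j hij => (hd hij).mono inter_subset_right inter_subset_right)
    fun i => hS.inter (hB i), tsum_fintype]

/-- The part of the block within distance `t` of its left end has measure `t`. -/
theorem volume_blockInterval_inter (hα : ∀ i, 0 ≤ α i) (i : Fin k) {t : ℝ}
    (ht0 : 0 ≤ t) (ht : t ≤ α i / ∑ j, α j) :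
    volume (blockInterval α i ∩ {x : I | (x : ℝ) ≤ (∑ j ∈ Finset.Iio i, α j) / ∑ j, α j + t})
      = ENNReal.ofReal t := by
  set s := (∑ j ∈ Finset.Iio i, α j) / ∑ j, α j with hs
  have hs0 : 0 ≤ s :=
    div_nonneg (Finset.sum_nonneg fun j _ => hα j) (Finset.sum_nonneg fun j _ => hα j)
  have hst := sum_Iic_div_eq (α := α) i
  have hst1 := sum_Iic_div_le_one hα i
  rw [← hs] at hst
  let a : I := ⟨s, hs0, by linarith⟩
  let b : I := ⟨s + t, by linarith, by linarith⟩
  refine le_antisymm ?_ ?_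
  · calc _ ≤ volume (Icc a b) := measure_mono fun x hx => ⟨hx.1.1, hx.2⟩
      _ = _ := by rw [unitInterval.volume_Icc]; simp [a, b]
  · calc _ = volume (Ico a b) := by rw [unitInterval.volume_Ico]; simp [a, b]
      _ ≤ _ := measure_mono fun x hx => by
        have h1 : s ≤ (x : ℝ) := hx.1
        have h2 : (x : ℝ) < s + t := hx.2
        exact ⟨⟨h1, Or.inl (by linarith)⟩, h2.le⟩

theorem volume_blockInterval (hα : ∀ i, 0 ≤ α i) (hα0 : α ≠ 0) (i : Fin k) :
    volume (blockInterval α i) = ENNReal.ofReal (α i / ∑ j, α j) := by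
  rw [← volume_blockInterval_inter hα i
    (div_nonneg (hα i) (Finset.sum_nonneg fun j _ => hα j)) le_rfl, inter_eq_left.2]
  intro x hx
  have := le_of_mem_blockInterval hα hα0 hx
  rwa [sum_Iic_div_eq] at this

/-- The quantile transform: `x ↦ inf {y | x ≤ s + μ [0, y]}`, with `s` the left end of the block,
pushes Lebesgue measure on the block to `μ`. -/
theorem exists_map_restrict_blockInterval (hα : ∀ i, 0 ≤ α i) (hα0 : α ≠ 0) (i : Fin k)
    (μ : Measure I) (hμ : μ univ = volume (blockInterval α i)) :
    ∃ θ : I → I, Measurable θ ∧ (volume.restrict (blockInterval α i)).map θ = μ := by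
  have hfin : IsFiniteMeasure μ := ⟨hμ ▸ measure_lt_top _ _⟩
  set s := (∑ j ∈ Finset.Iio i, α j) / ∑ j, α j with hs
  set β := α i / ∑ j, α j with hβ
  have hβ0 : 0 ≤ β := div_nonneg (hα i) (Finset.sum_nonneg fun j _ => hα j)
  set G : I → ℝ := fun y => (μ (Iic y)).toReal with hG
  have hGmono : Monotone G := fun y z h =>
    ENNReal.toReal_mono (measure_ne_top _ _) (measure_mono (Iic_subset_Iic.2 h))
  have hG1 : G 1 = β := by
    have : Iic (1 : I) = univ := eq_univ_of_forall fun x => x.2.2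
    rw [hG]
    simp only [this, hμ]
    rw [volume_blockInterval hα hα0, ENNReal.toReal_ofReal hβ0]
  have hGβ : ∀ y, G y ≤ β := fun y => hG1 ▸ hGmono y.2.2
  let θ : I → I := fun x => sInf {y | (x : ℝ) ≤ s + G y}
  have hθmono : Monotone θ := fun x x' h =>
    sInf_le_sInf fun y hy => (show (x : ℝ) ≤ x' from h).trans hy
  -- right continuity of `G` makes the infimum attained
  have hgalois : ∀ x : I, (x : ℝ) ≤ s + β → ∀ y, θ x ≤ y ↔ (x : ℝ) ≤ s + G y := by
    intro x hx y
    refine ⟨fun h => ?_, fun h => sInf_le h⟩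
    rcases eq_or_lt_of_le (show y ≤ 1 from y.2.2) with rfl | hy1
    · rwa [hG1]
    have hgt : ∀ y', y < y' → (x : ℝ) ≤ s + G y' := by
      intro y' hy'
      obtain ⟨z, hz, hzy⟩ := sInf_lt_iff.1 (h.trans_lt hy')
      exact hz.trans (add_le_add_right (hGmono hzy.le) s)
    have hlim : Tendsto (fun r => μ (Iic r)) (𝓝[>] y) (𝓝 (μ (Iic y))) := by
      have := tendsto_measure_biInter_gt (μ := μ) (s := fun r : I => Iic r) (a := y)
        (fun r _ => measurableSet_Iic.nullMeasurableSet) (fun i j _ hij => Iic_subset_Iic.2 hij)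
        ⟨1, hy1, measure_ne_top _ _⟩
      have he : ⋂ r > y, Iic r = Iic y := by
        ext z
        simp only [mem_iInter, mem_Iic]
        exact ⟨fun h => le_of_forall_gt_imp_ge_of_dense h, fun h r hr => h.trans (le_of_lt hr)⟩
      rwa [he] at this
    have hlim' : Tendsto (fun r => s + G r) (𝓝[>] y) (𝓝 (s + G y)) :=
      ((ENNReal.tendsto_toReal (measure_ne_top _ _)).comp hlim).const_add s
    have : (𝓝[>] y).NeBot := nhdsGT_neBot_of_exists_gt ⟨1, hy1⟩
    exact ge_of_tendsto hlim' (eventually_nhdsWithin_of_forall hgt)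
  refine ⟨θ, hθmono.measurable, ?_⟩
  refine Measure.ext_of_Iic _ _ fun y => ?_
  rw [Measure.map_apply hθmono.measurable measurableSet_Iic,
    Measure.restrict_apply (hθmono.measurable measurableSet_Iic)]
  have hset : θ ⁻¹' Iic y ∩ blockInterval α i
      = blockInterval α i ∩ {x : I | (x : ℝ) ≤ s + G y} := by
    ext x
    rw [inter_comm]
    refine and_congr_right fun hx => hgalois x ?_ y
    have := le_of_mem_blockInterval hα hα0 hx
    rwa [sum_Iic_div_eq] at this
  rw [hset, volume_blockInterval_inter hα i ENNReal.toReal_nonneg (hGβ y),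
    ENNReal.ofReal_toReal (measure_ne_top _ _)]

/-- Measures `μ i` that sum to Lebesgue measure and have the masses of the blocks are the images of
the blocks under one measure-preserving map. -/
theorem exists_isMeasPres_map_restrict (hα : ∀ i, 0 ≤ α i) (hα0 : α ≠ 0) (μ : Fin k → Measure I)
    (hμ : ∀ i, μ i univ = volume (blockInterval α i))
    (hsum : ∀ S, MeasurableSet S → ∑ i, μ i S = volume S) :
    ∃ θ : I → I, Measurable θ ∧ IsMeasPres θ ∧
      ∀ i, (volume.restrict (blockInterval α i)).map θ = μ i := by
  choose θ hθ hθμ using fun i => exists_map_restrict_blockInterval hα hα0 i (μ i) (hμ i)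
  choose c hc using fun x => exists_mem_blockInterval hα0 x
  have hceq : ∀ i, ∀ x ∈ blockInterval α i, c x = i := by
    intro i x hx
    by_contra h
    exact disjoint_left.1 (pairwise_disjoint_blockInterval hα h) (hc x) hx
  let Θ : I → I := fun x => θ (c x) x
  have hΘeq : ∀ i, ∀ S : Set I, Θ ⁻¹' S ∩ blockInterval α i = θ i ⁻¹' S ∩ blockInterval α i := by
    intro i S
    ext x
    simp only [mem_inter_iff, mem_preimage, Θ]
    exact and_congr_left fun hx => by rw [hceq i x hx]
  have hΘ : Measurable Θ := by
    intro S hS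
    rw [← inter_univ (Θ ⁻¹' S), ← iUnion_blockInterval hα0, inter_iUnion]
    refine MeasurableSet.iUnion fun i => ?_
    rw [hΘeq]
    exact (hθ i hS).inter (measurableSet_blockInterval i)
  have hΘμ : ∀ i, (volume.restrict (blockInterval α i)).map Θ = μ i := by
    intro i
    rw [← hθμ i]
    ext S hS
    rw [Measure.map_apply hΘ hS, Measure.map_apply (hθ i) hS, Measure.restrict_apply (hΘ hS),
      Measure.restrict_apply (hθ i hS), hΘeq]
  refine ⟨Θ, hΘ, ⟨hΘ.aemeasurable, ?_⟩, hΘμ⟩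
  ext S hS
  rw [← hsum S hS, Measure.map_apply hΘ hS, ← sum_measure_inter volume measurableSet_blockInterval
    (pairwise_disjoint_blockInterval hα) (iUnion_blockInterval hα0) (hΘ hS)]
  refine Finset.sum_congr rfl fun i _ => ?_
  rw [← hΘμ i, Measure.map_apply hΘ hS, Measure.restrict_apply (hΘ hS)]

end Blocks

/-! ### Relative entropy as a supremum of affine functions -/

section Entropy

theorem measurable_relEntropy (p : ℝ) : Measurable (relEntropy p) := by
  unfold relEntropy
  refine Measurable.ite ?_ measurable_const (by fun_prop)
  have h0 : MeasurableSet {ρ : ℝ | ρ ≠ 0} := (measurableSet_singleton 0).compl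
  have h1 : MeasurableSet {ρ : ℝ | ρ ≠ 1} := (measurableSet_singleton 1).compl
  exact ((MeasurableSet.const _).inter h0).union ((MeasurableSet.const _).inter h1)

/-- Half of the tangent inequality for `h_p` at `q`: adding the same bound for `1 - t`, `1 - q`,
`1 - p` cancels the error terms `q - t`. -/
theorem mul_log_div_le {p q t : ℝ} (hp : 0 < p) (hq : 0 < q) (ht : 0 ≤ t) :
    t * Real.log (q / p) ≤ t * Real.log (t / p) + (q - t) := by
  rcases ht.eq_or_lt with rfl | ht
  · simpa using hq.le
  have h1 : Real.log (q / p) = Real.log (t / p) + Real.log (q / t) := by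
    rw [← Real.log_mul (by positivity) (by positivity)]
    congr 1
    field_simp
  have h2 := mul_le_mul_of_nonneg_left (Real.log_le_sub_one_of_pos (div_pos hq ht)) ht.le
  have h3 : t * (q / t - 1) = q - t := by field_simp
  rw [h1, mul_add]
  linarith

/-- Half of the bound that, at `t`, the tangent to `h_p` at `(1 - s) t + s / 2` falls short of `h_p`
by at most `-log (1 - s)`. -/
theorem mul_log_div_ge {p t s q : ℝ} (hp : 0 < p) (ht : 0 ≤ t) (hs : s < 1)
    (hq : (1 - s) * t ≤ q) :
    t * Real.log (t / p) + t * Real.log (1 - s) ≤ t * Real.log (q / p) := by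
  rcases ht.eq_or_lt with rfl | ht
  · simp
  have hs' : 0 < 1 - s := by linarith
  rw [← mul_add, ← Real.log_mul (by positivity) (by positivity)]
  refine mul_le_mul_of_nonneg_left (Real.log_le_log (by positivity) ?_) ht.le
  rw [div_mul_eq_mul_div, mul_comm t]
  exact div_le_div_of_nonneg_right hq hp.le

theorem relEntropy_eq_iSup_of_mem_Ioo {p : ℝ} (hp : p ∈ Ioo (0 : ℝ) 1) :
    ∃ a b : ℕ → ℝ, ∀ t ∈ Icc (0 : ℝ) 1,
      relEntropy p t = ⨆ l, ENNReal.ofReal (a l * t + b l) := by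
  have hp0 : 0 < p := hp.1
  have hp1 : 0 < 1 - p := by linarith [hp.2]
  have : Nonempty (Ioo (0 : ℝ) 1) := ⟨⟨p, hp⟩⟩
  let tang : Ioo (0 : ℝ) 1 → ℝ → ℝ := fun q t =>
    t * Real.log (q / p) + (1 - t) * Real.log ((1 - q) / (1 - p))
  -- `tang r` is the tangent to `h_p` at `r`; countably many `r` suffice by continuity
  let q : ℕ → Ioo (0 : ℝ) 1 := TopologicalSpace.denseSeq _
  refine ⟨fun l => Real.log (q l / p) - Real.log ((1 - q l) / (1 - p)),
    fun l => Real.log ((1 - q l) / (1 - p)), fun t ht => ?_⟩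
  have hrw : ∀ l, (Real.log (q l / p) - Real.log ((1 - q l) / (1 - p))) * t
      + Real.log ((1 - q l) / (1 - p)) = tang (q l) t := fun l => by
    simp only [tang]; ring
  simp_rw [hrw]
  have hrel : relEntropy p t = ENNReal.ofReal
      (t * Real.log (t / p) + (1 - t) * Real.log ((1 - t) / (1 - p))) := by
    rw [relEntropy, if_neg]
    rintro (h | h)
    · exact hp0.ne' h.1
    · exact hp.2.ne h.1
  rw [hrel]
  have ht' : 0 ≤ 1 - t := by linarith [ht.2]
  refine le_antisymm ?_ (iSup_le fun l => ENNReal.ofReal_le_ofReal ?_)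
  · have hcont : Continuous fun r : Ioo (0 : ℝ) 1 => ENNReal.ofReal (tang r t) := by
      refine ENNReal.continuous_ofReal.comp ?_
      refine (continuous_const.mul (Continuous.log (by fun_prop) fun r => ?_)).add
        (continuous_const.mul (Continuous.log (by fun_prop) fun r => ?_))
      · exact (div_pos r.2.1 hp0).ne'
      · exact (div_pos (by linarith [r.2.2]) hp1).ne'
    have hall : ∀ r : Ioo (0 : ℝ) 1,
        ENNReal.ofReal (tang r t) ≤ ⨆ l, ENNReal.ofReal (tang (q l) t) := by
      have hcl : IsClosed {r : Ioo (0 : ℝ) 1 |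
          ENNReal.ofReal (tang r t) ≤ ⨆ l, ENNReal.ofReal (tang (q l) t)} :=
        isClosed_le hcont continuous_const
      exact fun r => hcl.closure_subset_iff.2
        (range_subset_iff.2 fun l => le_iSup (fun l => ENNReal.ofReal (tang (q l) t)) l)
        (TopologicalSpace.denseRange_denseSeq _ r)
    -- the tangent points `(1 - s) t + s / 2` stay in `(0,1)` even if `t` is an end point
    set H := t * Real.log (t / p) + (1 - t) * Real.log ((1 - t) / (1 - p)) with hH
    have hlim : Tendsto (fun s : ℝ => ENNReal.ofReal (H + Real.log (1 - s))) (𝓝[>] 0)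
        (𝓝 (ENNReal.ofReal H)) := by
      refine (ENNReal.continuous_ofReal.tendsto _).comp ?_
      have : ContinuousAt (fun s : ℝ => H + Real.log (1 - s)) 0 :=
        continuousAt_const.add (ContinuousAt.log (by fun_prop) (by norm_num))
      have h := this.tendsto
      simp only [sub_zero, Real.log_one, add_zero] at h
      exact h.mono_left nhdsWithin_le_nhds
    refine le_of_tendsto hlim ?_
    filter_upwards [Ioo_mem_nhdsGT (zero_lt_one' ℝ)] with s hs
    have hr : (1 - s) * t + s / 2 ∈ Ioo (0 : ℝ) 1 := by
      constructor
      · have := mul_nonneg (by linarith [hs.2] : 0 ≤ 1 - s) ht.1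
        linarith [hs.1]
      · have := mul_le_mul_of_nonneg_left ht.2 (by linarith [hs.2] : 0 ≤ 1 - s)
        linarith [hs.1]
    refine (ENNReal.ofReal_le_ofReal ?_).trans (hall ⟨_, hr⟩)
    have h1 := mul_log_div_ge hp0 ht.1 hs.2 (q := (1 - s) * t + s / 2) (by linarith [hs.1])
    have h2 := mul_log_div_ge hp1 ht' hs.2 (q := 1 - ((1 - s) * t + s / 2))
      (by linarith [hs.1])
    simp only [tang, hH]
    linarith
  · have h1 := mul_log_div_le hp0 (q l).2.1 ht.1
    have h2 := mul_log_div_le hp1 (q := 1 - q l) (by linarith [(q l).2.2]) ht'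
    simp only [tang]
    linarith

theorem iSup_ofReal_natCast_mul {t : ℝ} (ht : 0 < t) :
    ⨆ l : ℕ, ENNReal.ofReal (l * t) = ⊤ := by
  refine iSup_eq_top.2 fun b hb => ?_
  obtain ⟨l, hl⟩ := exists_nat_gt (b.toReal / t)
  refine ⟨l, (ENNReal.lt_ofReal_iff_toReal_lt hb.ne).2 ?_⟩
  rwa [div_lt_iff₀ ht] at hl

/-- On `[0,1]` the function `h_p` is a supremum of countably many affine functions: tangents if
`0 < p < 1`, and lines of growing slope through the only point of finite entropy otherwise. -/
theorem relEntropy_eq_iSup {p : ℝ} (hp : p ∈ Icc (0 : ℝ) 1) :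
    ∃ a b : ℕ → ℝ, ∀ t ∈ Icc (0 : ℝ) 1,
      relEntropy p t = ⨆ l, ENNReal.ofReal (a l * t + b l) := by
  rcases eq_or_lt_of_le hp.1 with rfl | h0
  · refine ⟨fun l => l, fun _ => 0, fun t ht => ?_⟩
    simp only [add_zero]
    rcases eq_or_lt_of_le ht.1 with rfl | ht0
    · simp [relEntropy]
    · rw [iSup_ofReal_natCast_mul ht0, relEntropy, if_pos (Or.inl ⟨rfl, ht0.ne'⟩)]
  rcases eq_or_lt_of_le hp.2 with rfl | h1
  · refine ⟨fun l => -l, fun l => l, fun t ht => ?_⟩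
    have hrw : ∀ l : ℕ, -(l : ℝ) * t + l = l * (1 - t) := fun l => by ring
    simp_rw [hrw]
    rcases eq_or_lt_of_le ht.2 with rfl | ht1
    · simp [relEntropy]
    · rw [iSup_ofReal_natCast_mul (by linarith), relEntropy, if_pos (Or.inr ⟨rfl, ht1.ne⟩)]
  · exact relEntropy_eq_iSup_of_mem_Ioo ⟨h0, h1⟩

end Entropy

/-! ### Limits of block entropies -/

section Limit

variable {k : ℕ} {α : Fin k → ℝ} {p : Matrix (Fin k) (Fin k) ℝ}

theorem blockEntropy_eq_of_ae {V : Graphon} {v : I × I → ℝ} (h : V.toFun =ᵐ[volume] v) :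
    blockEntropy α p V = 2⁻¹ * ∑ i, ∑ j,
      ∫⁻ z, relEntropy (p i j) (v z) ∂((volume.restrict (blockInterval α i)).prod
        (volume.restrict (blockInterval α j))) := by
  unfold blockEntropy
  congr 1
  refine Finset.sum_congr rfl fun i _ => Finset.sum_congr rfl fun j _ => ?_
  rw [Measure.prod_restrict, ← Measure.volume_eq_prod]
  refine lintegral_congr_ae ?_
  filter_upwards [ae_restrict_of_ae h] with z hz
  rw [hz]

theorem toReal_lintegral_ofReal {X : Type*} [MeasurableSpace X] {m : Measure X}
    [IsFiniteMeasure m] {f : X → ℝ} (hf : Measurable f) (h01 : ∀ x, f x ∈ Icc (0 : ℝ) 1) :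
    (∫⁻ x, ENNReal.ofReal (f x) ∂m).toReal = ∫ x, f x ∂m := by
  rw [integral_eq_lintegral_of_nonneg_ae (Eventually.of_forall fun y => (h01 y).1)
    hf.aestronglyMeasurable]

/-- Let the laws of `f` under `ρ n` converge setwise to `ν`. If the integrals of `u ∘ f` and `w n`
over preimages of rectangles merge, then over the preimage of any measurable `S` the integral of
`w n` tends to `∫_S u ∂ν`. Indeed, the measures with densities `w n`, pushed forward by `f`, have a
setwise limit, and rectangles determine it. -/
theorem tendsto_setLIntegral_of_rectangles {X Y : Type*} [MeasurableSpace X] [MeasurableSpace Y]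
    (𝒰 : Ultrafilter ℕ) {m : Measure (X × X)} [IsFiniteMeasure m] {ν : Measure (X × X)}
    [IsFiniteMeasure ν] {ρ : ℕ → Measure Y} [∀ n, IsFiniteMeasure (ρ n)] {f : Y → X × X}
    (hf : Measurable f) (hρ : ∀ n, (ρ n).map f ≤ m)
    (hν : ∀ S, MeasurableSet S → Tendsto (fun n => (ρ n).map f S) 𝒰 (𝓝 (ν S)))
    {u : X × X → ℝ} (hu : Measurable u) (hu01 : ∀ z, u z ∈ Icc (0 : ℝ) 1)
    {w : ℕ → Y → ℝ} (hw : ∀ n, Measurable (w n)) (hw01 : ∀ n z, w n z ∈ Icc (0 : ℝ) 1)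
    (hrect : ∀ A B : Set X, MeasurableSet A → MeasurableSet B →
      Tendsto (fun n => ∫ y in f ⁻¹' (A ×ˢ B), (u (f y) - w n y) ∂(ρ n)) 𝒰 (𝓝 0))
    {S : Set (X × X)} (hS : MeasurableSet S) :
    Tendsto (fun n => ∫⁻ y in f ⁻¹' S, ENNReal.ofReal (w n y) ∂(ρ n)) 𝒰
      (𝓝 (∫⁻ z in S, ENNReal.ofReal (u z) ∂ν)) := by
  set τ : ℕ → Measure (X × X) := fun n =>
    ((ρ n).withDensity fun y => ENNReal.ofReal (w n y)).map f with hτ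
  have hτS : ∀ n S, MeasurableSet S →
      τ n S = ∫⁻ y in f ⁻¹' S, ENNReal.ofReal (w n y) ∂(ρ n) := fun n S hS => by
    rw [hτ, Measure.map_apply hf hS, withDensity_apply _ (hf hS)]
  have hτle : ∀ n, τ n ≤ (ρ n).map f := fun n => by
    exact Measure.map_mono (withDensity_ofReal_le _ (hw01 n)) hf
  obtain ⟨τ', hτ'm, hτ'⟩ := exists_setwise_limit 𝒰 m τ fun n => (hτle n).trans (hρ n)
  have hfin := isFiniteMeasure_of_le m hτ'm
  have hτn : ∀ n, IsFiniteMeasure (τ n) := fun n => isFiniteMeasure_of_le _ (hτle n)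
  have hσfin : IsFiniteMeasure (ν.withDensity fun z => ENNReal.ofReal (u z)) :=
    isFiniteMeasure_of_le ν (withDensity_ofReal_le _ hu01)
  have heq : τ' = ν.withDensity fun z => ENNReal.ofReal (u z) := by
    refine Measure.ext_prod fun {A B} hA hB => ?_
    have hAB := hA.prod hB
    rw [← ENNReal.toReal_eq_toReal_iff' (measure_ne_top _ _) (measure_ne_top _ _)]
    have h1 : Tendsto (fun n => (τ n (A ×ˢ B)).toReal) 𝒰 (𝓝 (τ' (A ×ˢ B)).toReal) :=
      (ENNReal.tendsto_toReal (measure_ne_top _ _)).comp (hτ' _ hAB)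
    have h2 : Tendsto (fun n => (∫⁻ z in A ×ˢ B, ENNReal.ofReal (u z) ∂((ρ n).map f)).toReal) 𝒰
        (𝓝 ((ν.withDensity fun z => ENNReal.ofReal (u z)) (A ×ˢ B)).toReal) := by
      refine (ENNReal.tendsto_toReal (measure_ne_top _ _)).comp ?_
      rw [withDensity_apply _ hAB]
      simp_rw [← lintegral_indicator hAB]
      refine tendsto_lintegral_of_setwise 𝒰 hν
        ((ENNReal.measurable_ofReal.comp hu).indicator hAB) fun z => ?_
      exact indicator_le_self' (fun _ _ => zero_le) z |>.trans (by simpa using (hu01 z).2)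
    have h3 := h2.sub (hrect A B hA hB)
    rw [sub_zero] at h3
    refine tendsto_nhds_unique h1 (h3.congr fun n => ?_)
    rw [hτS n _ hAB, setLIntegral_map hAB (by fun_prop) hf,
      toReal_lintegral_ofReal (f := fun y => u (f y)) (hu.comp hf) fun _ => hu01 _,
      toReal_lintegral_ofReal (hw n) (hw01 n), integral_sub]
    · ring
    · exact integrable_of_mem_Icc (f := fun y => u (f y)) (hu.comp hf).aemeasurable
        fun _ => hu01 _
    · exact integrable_of_mem_Icc (hw n).aemeasurable (hw01 n)
  have := hτ' S hS
  rw [heq, withDensity_apply _ hS] at this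
  exact this.congr fun n => hτS n S hS

/-- Limits of entropies are attained by a pull-back of the limit graphon `U`. The couplings of `U` with
`V n` label the points of `U` by the blocks of `V n`; a limit of the labels is a decomposition of
Lebesgue measure into measures `μ i`, and `θ` sends the `i`-th block to `μ i`. -/
theorem exists_pullback_blockEntropy_le (hp01 : ∀ i j, p i j ∈ Icc (0 : ℝ) 1)
    (hα : ∀ i, 0 ≤ α i) (hα0 : α ≠ 0) {U : Graphon} {V : ℕ → Graphon} {u : I × I → ℝ}
    {v : ℕ → I × I → ℝ} (hu : Measurable u) (hu01 : ∀ z, u z ∈ Icc (0 : ℝ) 1)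
    (hUu : U.toFun =ᵐ[volume] u) (hv : ∀ n, Measurable (v n))
    (hv01 : ∀ n z, v n z ∈ Icc (0 : ℝ) 1) (hVv : ∀ n, (V n).toFun =ᵐ[volume] v n)
    {ε : ℕ → ℝ} (hε : Tendsto ε atTop (𝓝 0)) (hclose : ∀ n, CouplingClose u (v n) (ε n))
    {C : ℝ≥0∞} (hC : ∀ n, blockEntropy α p (V n) ≤ C) :
    ∃ (θ : I → I) (hθ : IsMeasPres θ), blockEntropy α p (U.pullback θ hθ) ≤ C := by
  set 𝒰 : Ultrafilter ℕ := hyperfilter ℕ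
  have h𝒰 : (𝒰 : Filter ℕ) ≤ atTop := Nat.hyperfilter_le_atTop
  choose π hπ1 hπ2 hπ using hclose
  have hprob : ∀ n, IsProbabilityMeasure (π n) := fun n => isProbabilityMeasure_of_map_fst (hπ1 n)
  set B : Fin k → Set I := blockInterval α with hB
  have hBm : ∀ i, MeasurableSet (B i) := measurableSet_blockInterval
  -- `M n i` is the part of the coupling in which the point of `V n` lies in the `i`-th block
  set M : ℕ → Fin k → Measure (I × I) := fun n i => (π n).restrict (Prod.snd ⁻¹' B i) with hM
  have hMfst : ∀ n i, (M n i).map Prod.fst ≤ volume := fun n i => by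
    rw [← hπ1 n]
    exact Measure.map_mono Measure.restrict_le_self measurable_fst
  have hMsnd : ∀ n i, (M n i).map Prod.snd = volume.restrict (B i) := fun n i => by
    rw [hM, ← Measure.restrict_map measurable_snd (hBm i), hπ2 n]
  choose μ hμle hμ using fun i =>
    exists_setwise_limit 𝒰 volume (fun n => (M n i).map Prod.fst) fun n => hMfst n i
  have hμfin : ∀ i, IsFiniteMeasure (μ i) := fun i => isFiniteMeasure_of_le _ (hμle i)
  have hMS : ∀ n i S, MeasurableSet S →
      (M n i).map Prod.fst S = π n (Prod.fst ⁻¹' S ∩ Prod.snd ⁻¹' B i) := fun n i S hS => by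
    rw [Measure.map_apply measurable_fst hS, Measure.restrict_apply (measurable_fst hS)]
  have hμuniv : ∀ i, μ i univ = volume (B i) := by
    intro i
    refine tendsto_nhds_unique (hμ i univ .univ) (tendsto_const_nhds.congr fun n => ?_)
    rw [hMS n i _ .univ, preimage_univ, univ_inter, ← hπ2 n,
      Measure.map_apply measurable_snd (hBm i)]
  have hμsum : ∀ S, MeasurableSet S → ∑ i, μ i S = volume S := by
    intro S hS
    refine tendsto_nhds_unique (tendsto_finsetSum _ fun i _ => hμ i S hS)
      (tendsto_const_nhds.congr fun n => ?_)
    simp_rw [hMS n _ S hS]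
    rw [sum_measure_inter (π n) (fun i => measurable_snd (hBm i))
      (fun i j hij => (pairwise_disjoint_blockInterval hα hij).preimage _)
      (by rw [← preimage_iUnion, hB, iUnion_blockInterval hα0, preimage_univ])
      (measurable_fst hS), ← hπ1 n, Measure.map_apply measurable_fst hS]
  obtain ⟨θ, hθm, hθ, hθμ⟩ := exists_isMeasPres_map_restrict hα hα0 μ hμuniv hμsum
  refine ⟨θ, hθ, ?_⟩
  have hθ2 : ∀ i j, ((volume.restrict (B i)).prod (volume.restrict (B j))).map (Prod.map θ θ)
      = (μ i).prod (μ j) := fun i j => by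
    rw [← Measure.map_prod_map _ _ hθm hθm, hθμ, hθμ]
  have hUθ : (U.pullback θ hθ).toFun =ᵐ[volume] fun z => u (Prod.map θ θ z) := by
    refine ae_of_ae_map (f := Prod.map θ θ) (p := fun z => U.toFun z = u z) hθ.prodMap.1 ?_
    rw [hθ.prodMap.2]
    exact hUu
  set R : ℕ → Fin k → Fin k → Measure ((I × I) × (I × I)) := fun n i j => (M n i).prod (M n j)
  -- under `R n i j`, `f₁` gives a pair of points of `U` and `f₂` the coupled pair of points of `V n`
  let f₁ : (I × I) × (I × I) → I × I := Prod.map Prod.fst Prod.fst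
  let f₂ : (I × I) × (I × I) → I × I := Prod.map Prod.snd Prod.snd
  have hf₁ : Measurable f₁ := measurable_fst.prodMap measurable_fst
  have hf₂ : Measurable f₂ := measurable_snd.prodMap measurable_snd
  have hR1 : ∀ n i j, (R n i j).map f₁ = ((M n i).map Prod.fst).prod ((M n j).map Prod.fst) :=
    fun n i j => (Measure.map_prod_map _ _ measurable_fst measurable_fst).symm
  have hR2 : ∀ n i j, (R n i j).map f₂ = (volume.restrict (B i)).prod (volume.restrict (B j)) :=
    fun n i j => by
      rw [← hMsnd n i, ← hMsnd n j]
      exact (Measure.map_prod_map _ _ measurable_snd measurable_snd).symm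
  have hν : ∀ i j S, MeasurableSet S →
      Tendsto (fun n => (R n i j).map f₁ S) 𝒰 (𝓝 ((μ i).prod (μ j) S)) := by
    intro i j S hS
    simp_rw [hR1]
    exact tendsto_prod_of_setwise 𝒰 (fun n => hMfst n i) (fun n => hMfst n j) (hμle i) (hμle j)
      (hμ i) (hμ j) hS
  choose c hc using fun i j => exists_tendsto_ennreal 𝒰
    (fun n => ∫⁻ w, relEntropy (p i j) (v n (f₂ w)) ∂(R n i j))
  have hblock : ∀ i j, ∫⁻ z, relEntropy (p i j) (u z) ∂((μ i).prod (μ j)) ≤ c i j := by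
    intro i j
    obtain ⟨a, b, hab⟩ := relEntropy_eq_iSup (hp01 i j)
    refine lintegral_le_of_iSup_affine 𝒰 hu hu01 hf₁ (fun n => (hv n).comp hf₂)
      (fun n w => hv01 n _) ?_ ?_ hab (hc i j)
    · intro S hS
      refine (hν i j S hS).congr fun n => ?_
      rw [Measure.map_apply hf₁ hS]
    · intro S hS
      refine tendsto_setLIntegral_of_rectangles 𝒰 (m := volume.prod volume) hf₁ (fun n => ?_)
        (hν i j) hu hu01 (fun n => (hv n).comp hf₂) (fun n w => hv01 n _) ?_ hS
      · rw [hR1]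
        exact Measure.prod_mono (hMfst n i) (hMfst n j)
      · intro A A' hA hA'
        refine squeeze_zero_norm (fun n => ?_) (hε.mono_left h𝒰)
        have hpre : f₁ ⁻¹' (A ×ˢ A') = (Prod.fst ⁻¹' A) ×ˢ (Prod.fst ⁻¹' A') := rfl
        rw [hpre, ← Measure.prod_restrict]
        exact hπ n _ _ (Measure.restrict_le_self.trans Measure.restrict_le_self)
          (Measure.restrict_le_self.trans Measure.restrict_le_self)
  calc blockEntropy α p (U.pullback θ hθ)
      = 2⁻¹ * ∑ i, ∑ j, ∫⁻ z, relEntropy (p i j) (u z) ∂((μ i).prod (μ j)) := by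
        rw [blockEntropy_eq_of_ae hUθ]
        congr 1
        refine Finset.sum_congr rfl fun i _ => Finset.sum_congr rfl fun j _ => ?_
        rw [← hθ2]
        exact (lintegral_map ((measurable_relEntropy _).comp hu) (hθm.prodMap hθm)).symm
    _ ≤ 2⁻¹ * ∑ i, ∑ j, c i j := by
        gcongr with i _ j _
        exact hblock i j
    _ ≤ C := by
        refine le_of_tendsto (ENNReal.Tendsto.const_mul (tendsto_finsetSum _ fun i _ =>
          tendsto_finsetSum _ fun j _ => hc i j) (Or.inr (by simp)))
          (Eventually.of_forall fun n => ?_)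
        refine le_of_eq_of_le ?_ (hC n)
        rw [blockEntropy_eq_of_ae (hVv n)]
        congr 1
        refine Finset.sum_congr rfl fun i _ => Finset.sum_congr rfl fun j _ => ?_
        rw [← hR2 n i j]
        exact (lintegral_map ((measurable_relEntropy _).comp (hv n)) hf₂).symm

end Limit

/-- Representatives of two classes at distance below `ε` are linked by five couplings: to the chosen
centre of the class, to a representative that nearly attains the distance, across, and back. -/
theorem couplingClose_of_mem_of_cutDist_lt {S T : GraphonSpace} {U V : Graphon}
    (hU : U ∈ S.carrier) (hV : V ∈ T.carrier) {u v : I × I → ℝ} (hu : Measurable u)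
    (hu01 : ∀ z, u z ∈ Icc (0 : ℝ) 1) (hUu : U.toFun =ᵐ[volume] u) (hv : Measurable v)
    (hv01 : ∀ z, v z ∈ Icc (0 : ℝ) 1) (hVv : V.toFun =ᵐ[volume] v) {ε : ℝ} (hε : 0 < ε)
    (h : GraphonSpace.cutDist S T < ε) : CouplingClose u v (5 * ε) := by
  obtain ⟨U₀, hS⟩ := S.exists_rep
  obtain ⟨V₀, hT⟩ := T.exists_rep
  obtain ⟨_, ⟨U', hU', V', hV', rfl⟩, hlt⟩ := exists_lt_of_csInf_lt
    (by exact ⟨_, U, hU, V, hV, rfl⟩) h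
  rw [hS] at hU hU'
  rw [hT] at hV hV'
  obtain ⟨u₀, hu₀, hu₀01, hUu₀⟩ := U₀.exists_measurable_rep
  obtain ⟨v₀, hv₀, hv₀01, hVv₀⟩ := V₀.exists_measurable_rep
  obtain ⟨u', hu', hu'01, hUu'⟩ := U'.exists_measurable_rep
  obtain ⟨v', hv', hv'01, hVv'⟩ := V'.exists_measurable_rep
  have zero_lt : ∀ {X Y : Graphon}, cutDist X Y = 0 → cutDist X Y < ε := fun h => h ▸ hε
  have h1 := (couplingClose_of_cutDist_lt hu₀ hu hUu₀ hUu (zero_lt hU)).symm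
  have h2 := couplingClose_of_cutDist_lt hu₀ hu' hUu₀ hUu' (zero_lt hU')
  have h3 := couplingClose_of_cutDist_lt hu' hv' hUu' hVv' hlt
  have h4 := (couplingClose_of_cutDist_lt hv₀ hv' hVv₀ hVv' (zero_lt hV')).symm
  have h5 := couplingClose_of_cutDist_lt hv₀ hv hVv₀ hVv (zero_lt hV)
  have h12 := h1.trans hu hu₀ hu' hu01 hu₀01 hu'01 h2
  have h13 := h12.trans hu hu' hv' hu01 hu'01 hv'01 h3
  have h14 := h13.trans hu hv' hv₀ hu01 hv'01 hv₀01 h4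
  have h15 := h14.trans hu hv₀ hv hu01 hv₀01 hv01 h5
  convert h15 using 1
  ring

end BlockLDP

/-! ### Lower semicontinuity -/

open BlockLDP in
theorem theorem1p4 {k : ℕ} (p : Matrix (Fin k) (Fin k) ℝ) (hp : p.IsSymm)
    (hp01 : ∀ i j, p i j ∈ Set.Icc (0 : ℝ) 1)
    (α : Fin k → ℝ) (hα : ∀ i, 0 ≤ α i) (hα0 : α ≠ 0) :
    LowerSemicontinuous (BlockLDP.rateJ α p) := by
  rw [lowerSemicontinuous_iff_isOpen_preimage]
  intro y S hS
  by_contra! hcon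
  obtain ⟨C, hyC, hCS⟩ := exists_between (show y < rateJ α p S from hS)
  obtain ⟨U, hU⟩ := S.exists_rep
  have hUS : U ∈ S.carrier := hU ▸ cutDist_self U
  choose T hT hTy using fun n : ℕ => hcon (1 / ((n : ℝ) + 1)) Nat.one_div_pos_of_nat
  have hex : ∀ n, ∃ V ∈ (T n).carrier, blockEntropy α p V < C := by
    intro n
    have h : rateJ α p (T n) < C := (not_lt.1 (hTy n)).trans_lt hyC
    simpa only [rateJ, iInf_lt_iff, exists_prop] using h
  choose V hVT hVC using hex
  obtain ⟨u, hu, hu01, hUu⟩ := U.exists_measurable_rep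
  choose v hv hv01 hVv using fun n => (V n).exists_measurable_rep
  have hlim : Tendsto (fun n : ℕ => 5 * (1 / ((n : ℝ) + 1))) atTop (𝓝 0) := by
    simpa using tendsto_one_div_add_atTop_nhds_zero_nat.const_mul (5 : ℝ)
  obtain ⟨θ, hθ, hle⟩ := exists_pullback_blockEntropy_le hp01 hα hα0 hu hu01 hUu hv hv01 hVv hlim
    (fun n => couplingClose_of_mem_of_cutDist_lt hUS (hVT n) hu hu01 hUu (hv n) (hv01 n) (hVv n)
      Nat.one_div_pos_of_nat (hT n)) fun n => (hVC n).le
  -- the pull-back is weakly isomorphic to `U`, so that the infimum over the class is at most `C`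
  have hmem : U.pullback θ hθ ∈ S.carrier := hU ▸ cutDist_pullback U hθ
  exact absurd ((iInf₂_le _ hmem).trans hle) (not_le.2 hCS)
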